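/- **Conventions.** A *Real groupoid* $\mathcal G\rightrightarrows X$ is a topological groupoid whose arrow space $\mathcal G$ and unit space $X$ are locally compact Hausdorff, together with a continuous involution $g\mapsto\bar g$, $x\mapsto\bar x$ that is a functor. Products $gh$ are defined when $s(g)=r(h)$. A *Real strict morphism* is a continuous functor commuting with the involutions. A *Real generalized morphism* from $\Gamma\rightrightarrows Y$ to $\mathcal G\rightrightarrows X$ is a locally compact Hausdorff space $Z$ with a continuous involution, continuous involution-preserving maps $\mathfrak r:Z\to Y$ and $\mathfrak s:Z\to X$, and commuting continuous actions of $\Gamma$ on the left (along $\mathfrak r$, preserving $\mathfrak s$) and of $\mathcal G$ on the right (along $\mathfrak s$, preserving $\mathfrak r$) satisfying $\overline{\gamma z}=\bar\gamma\bar z$ and $\overline{zg}=\bar z\bar g$, such that $\mathfrak r:Z\to Y$ is a locally trivial principal $\mathcal G$-bundle; that is, $\mathfrak r$ has continuous local sections around every point of $Y$, and $(z,g)\mapsto(z,zg)$ is a homeomorphism from $\{(z,g):\mathfrak s(z)=r(g)\}$ onto $Z\times_YZ$. Two such are *isomorphic* if there is a $\Gamma$-$\mathcal G$-equivariant homeomorphism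 between them commuting with $\mathfrak r$, $\mathfrak s$ and the involutions. If $W$ is a Real generalized morphism from $\mathcal G$ to $\mathcal G'$, then $W\circ Z=Z\times_{\mathcal G}W$ is the quotient of $Z\times_XW$ by $(z,w)\sim(zg,g^{-1}w)$. $\mathsf{RG}$ is the category of Real groupoids with isomorphism classes of Real generalized morphisms as morphisms. A strict morphism $f:\Gamma\to\mathcal G$ defines $Z_f=Y\times_{f,X,r}\mathcal G$ with $\mathfrak r(y,g)=y$, $\mathfrak s(y,g)=s(g)$, $\gamma\cdot(y,g)=(r(\gamma),f(\gamma)g)$, $(y,g)\cdot g'=(y,gg')$. The identity of $\Gamma$ in $\mathsf{RG}$ is the class of $Z_{\mathrm{id}}$. If $\mathfrak s:Z\to X$ is also a locally trivial principal $\Gamma$-bundle, $Z^{-1}$ denotes the same Real space regarded as a generalized morphism from $\mathcal G$ to $\Gamma$, with $g\cdot z=zg^{-1}$ and $z\cdot\gamma=\gamma^{-1}z$. A *Real open cover* of $Y$ is a family $\mathcal U=(U_j)_{j\in J}$ of open sets with union $Y$, together with an involution $j\mapsto\bar j$ of $J$ such that $U_{\bar j}=\overline{U_j}$ for all $j$ (the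 image of $U_j$ under the involution of $Y$). The *cover groupoid* $\Gamma[\mathcal U]$ has unit space $\coprod_jU_j$ and arrows $(j_0,\gamma,j_1)$ with $r(\gamma)\in U_{j_0}$, $s(\gamma)\in U_{j_1}$, product $(j_0,\gamma,j_1)(j_1,\gamma',j_2)=(j_0,\gamma\gamma',j_2)$ and involution $(\bar j_0,\bar\gamma,\bar j_1)$. For the canonical strict morphism $\iota_{\mathcal U}:\Gamma[\mathcal U]\to\Gamma$, the generalized morphism $Z_{\iota_{\mathcal U}}$ has an inverse $Z_{\iota_{\mathcal U}}^{-1}$ in the above sense. Consider pairs $(\mathcal U,f_{\mathcal U})$ of a Real open cover $\mathcal U$ of $Y$ and a Real strict morphism $f_{\mathcal U}:\Gamma[\mathcal U]\to\mathcal G$. Call two pairs isomorphic if the associated generalized morphisms $Z_{f_{\mathcal U}}\circ Z_{\iota_{\mathcal U}}^{-1}$ from $\Gamma$ to $\mathcal G$ are isomorphic, and let $\Omega(\Gamma,\mathcal G)$ be the set of isomorphism classes. A composite of $(\mathcal U,f_{\mathcal U})$, from $\Gamma$ to $\mathcal G$, with $(\mathcal V,f_{\mathcal V})$, from $\mathcal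 G$ to $\mathcal G'$, is formed as follows. Choose a Real open cover $\mathcal W$ of the unit space of $\Gamma[\mathcal U]$ and a Real strict morphism $\varphi:\Gamma[\mathcal U][\mathcal W]\to\mathcal G[\mathcal V]$ with $Z_\varphi\circ Z_{\iota_{\mathcal W}}^{-1}\cong Z_{\iota_{\mathcal V}}^{-1}\circ Z_{f_{\mathcal U}}$. Let $\mathcal U'$ be the refinement of $\mathcal U$ by the sets $\{y\in U_j:(j,y)\in W_w\}$, indexed by the pairs $(w,j)$, so that $\Gamma[\mathcal U']\cong\Gamma[\mathcal U][\mathcal W]$ canonically. The composite is the class of $(\mathcal U',f_{\mathcal V}\circ\varphi)$. **Proposition.** 1. Composites exist, and their classes depend neither on the choices made nor on the representatives of the two classes. With this composition, and with the class of $(\{Y\},\Gamma[\{Y\}]\cong\Gamma)$ as the identity of $\Gamma\rightrightarrows Y$, the Real groupoids with the morphism sets $\Omega(\Gamma,\mathcal G)$ form a category $\mathsf{RG}_\Omega$. 2. There is a functor $F:\mathsf{RG}\to\mathsf{RG}_\Omega$ that is the identity on objects and sends the class of a Real generalized morphism $Z$ from $\Gamma$ to $\mathcal G$ to the class of the pairs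 $(\mathcal U,f_{\mathcal U})$ with $Z\cong Z_{f_{\mathcal U}}\circ Z_{\iota_{\mathcal U}}^{-1}$: for every pair, $F([Z])=[(\mathcal U,f_{\mathcal U})]$ if and only if $Z\cong Z_{f_{\mathcal U}}\circ Z_{\iota_{\mathcal U}}^{-1}$. 3. $F$ is an isomorphism of categories. -/

import Mathlib

open CategoryTheory

universe u

/-- A Real groupoid: a locally compact Hausdorff topological groupoid `Arr ⇉ Ob` with a strict
(i.e. functorial) continuous involution.  The product `mul g h` is defined when
`src g = rng h`. -/
structure RealGroupoid : Type (u + 1) where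
  Ob : Type u
  Arr : Type u
  [topOb : TopologicalSpace Ob]
  [topArr : TopologicalSpace Arr]
  [t2Ob : T2Space Ob]
  [t2Arr : T2Space Arr]
  [lcOb : LocallyCompactSpace Ob]
  [lcArr : LocallyCompactSpace Arr]
  src : Arr → Ob
  rng : Arr → Ob
  unit : Ob → Arr
  inv : Arr → Arr
  mul : (g h : Arr) → src g = rng h → Arr
  src_unit : ∀ x, src (unit x) = x
  rng_unit : ∀ x, rng (unit x) = x
  src_mul : ∀ g h (e : src g = rng h), src (mul g h e) = src h
  rng_mul : ∀ g h (e : src g = rng h), rng (mul g h e) = rng g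
  src_inv : ∀ g, src (inv g) = rng g
  rng_inv : ∀ g, rng (inv g) = src g
  mul_assoc : ∀ g h k (e₁ : src g = rng h) (e₂ : src h = rng k),
    mul (mul g h e₁) k ((src_mul g h e₁).trans e₂) =
      mul g (mul h k e₂) (e₁.trans (rng_mul h k e₂).symm)
  unit_mul : ∀ g, mul (unit (rng g)) g (src_unit _) = g
  mul_unit : ∀ g, mul g (unit (src g)) (rng_unit _).symm = g
  inv_mul : ∀ g, mul (inv g) g (src_inv g) = unit (src g)
  mul_inv : ∀ g, mul g (inv g) (rng_inv g).symm = unit (rng g)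
  continuous_src : Continuous src
  continuous_rng : Continuous rng
  continuous_unit : Continuous unit
  continuous_inv : Continuous inv
  continuous_mul : Continuous fun p : {p : Arr × Arr // src p.1 = rng p.2} =>
    mul p.1.1 p.1.2 p.2
  conjOb : Ob → Ob
  conjArr : Arr → Arr
  conjOb_conjOb : ∀ x, conjOb (conjOb x) = x
  conjArr_conjArr : ∀ g, conjArr (conjArr g) = g
  continuous_conjOb : Continuous conjOb
  continuous_conjArr : Continuous conjArr
  src_conj : ∀ g, src (conjArr g) = conjOb (src g)
  rng_conj : ∀ g, rng (conjArr g) = conjOb (rng g)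
  conj_unit : ∀ x, conjArr (unit x) = unit (conjOb x)
  conj_mul : ∀ g h (e : src g = rng h), conjArr (mul g h e) =
    mul (conjArr g) (conjArr h) (by rw [src_conj, rng_conj, e])

attribute [instance] RealGroupoid.topOb RealGroupoid.topArr RealGroupoid.t2Ob RealGroupoid.t2Arr
  RealGroupoid.lcOb RealGroupoid.lcArr

attribute [simp] RealGroupoid.src_unit RealGroupoid.rng_unit RealGroupoid.src_mul
  RealGroupoid.rng_mul RealGroupoid.src_inv RealGroupoid.rng_inv RealGroupoid.unit_mul
  RealGroupoid.mul_unit RealGroupoid.inv_mul RealGroupoid.mul_inv RealGroupoid.conjOb_conjOb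
  RealGroupoid.conjArr_conjArr RealGroupoid.src_conj RealGroupoid.rng_conj
  RealGroupoid.conj_unit RealGroupoid.conj_mul

namespace RealGroupoid

variable (G : RealGroupoid.{u})

lemma unit_mul' (x : G.Ob) (g : G.Arr) (e : G.src (G.unit x) = G.rng g) :
    G.mul (G.unit x) g e = g := by
  have : x = G.rng g := by simpa using e
  subst this; simp

lemma mul_unit' (x : G.Ob) (g : G.Arr) (e : G.src g = G.rng (G.unit x)) :
    G.mul g (G.unit x) e = g := by
  have : x = G.src g := by simpa using e.symm
  subst this; simp

lemma inv_mul_cancel_left (g h : G.Arr) (e : G.src g = G.rng h) :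
    G.mul (G.inv g) (G.mul g h e) (by simp) = h := by
  rw [← G.mul_assoc _ _ _ (by simp) e]
  simp [unit_mul']

lemma mul_inv_cancel_left (g h : G.Arr) (e : G.rng g = G.rng h) :
    G.mul g (G.mul (G.inv g) h (by simpa using e)) (by simp) = h := by
  rw [← G.mul_assoc _ _ _ (by simp) (by simpa using e)]
  simp [unit_mul']

lemma eq_inv_of_mul (g h : G.Arr) (e : G.src g = G.rng h)
    (H : G.mul g h e = G.unit (G.rng g)) : h = G.inv g := by
  have h1 := G.inv_mul_cancel_left g h e
  simp only [H, mul_unit'] at h1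
  exact h1.symm

@[simp] lemma inv_inv (g : G.Arr) : G.inv (G.inv g) = g :=
  (G.eq_inv_of_mul (G.inv g) g (by simp) (by simp)).symm

@[simp] lemma inv_unit (x : G.Ob) : G.inv (G.unit x) = G.unit x :=
  (G.eq_inv_of_mul (G.unit x) (G.unit x) (by simp) (by simp [unit_mul'])).symm

lemma inv_mul_rev (g h : G.Arr) (e : G.src g = G.rng h) :
    G.inv (G.mul g h e) = G.mul (G.inv h) (G.inv g) (by simp [e]) := by
  refine (G.eq_inv_of_mul _ _ (by simp) ?_).symm
  rw [G.mul_assoc _ _ _ e (by simp)]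
  have := G.mul_inv_cancel_left h (G.inv g) (by simp [e])
  simp [this]

@[simp] lemma conj_inv (g : G.Arr) : G.conjArr (G.inv g) = G.inv (G.conjArr g) := by
  refine G.eq_inv_of_mul _ _ (by simp) ?_
  rw [← G.conj_mul g (G.inv g) (by simp)]; simp

end RealGroupoid

/-- A Real strict morphism: a continuous functor commuting with the involutions. -/
structure StrictMor (Γ G : RealGroupoid.{u}) : Type u where
  onOb : Γ.Ob → G.Ob
  onArr : Γ.Arr → G.Arr
  continuous_onOb : Continuous onOb
  continuous_onArr : Continuous onArr
  src_onArr : ∀ γ, G.src (onArr γ) = onOb (Γ.src γ)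
  rng_onArr : ∀ γ, G.rng (onArr γ) = onOb (Γ.rng γ)
  map_unit : ∀ y, onArr (Γ.unit y) = G.unit (onOb y)
  map_mul : ∀ γ δ (e : Γ.src γ = Γ.rng δ), onArr (Γ.mul γ δ e) =
    G.mul (onArr γ) (onArr δ) (by rw [src_onArr, rng_onArr, e])
  conj_onOb : ∀ y, onOb (Γ.conjOb y) = G.conjOb (onOb y)
  conj_onArr : ∀ γ, onArr (Γ.conjArr γ) = G.conjArr (onArr γ)

attribute [simp] StrictMor.src_onArr StrictMor.rng_onArr StrictMor.map_unit StrictMor.map_mul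
  StrictMor.conj_onOb StrictMor.conj_onArr

namespace StrictMor

/-- The identity strict morphism. -/
def idStrict (G : RealGroupoid.{u}) : StrictMor G G where
  onOb x := x
  onArr g := g
  continuous_onOb := continuous_id
  continuous_onArr := continuous_id
  src_onArr _ := rfl
  rng_onArr _ := rfl
  map_unit _ := rfl
  map_mul _ _ _ := rfl
  conj_onOb _ := rfl
  conj_onArr _ := rfl

/-- `f.comp h` is the strict morphism `h ∘ f` (diagrammatic order). -/
def comp {Γ G H : RealGroupoid.{u}} (f : StrictMor Γ G) (h : StrictMor G H) : StrictMor Γ H where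
  onOb x := h.onOb (f.onOb x)
  onArr g := h.onArr (f.onArr g)
  continuous_onOb := h.continuous_onOb.comp f.continuous_onOb
  continuous_onArr := h.continuous_onArr.comp f.continuous_onArr
  src_onArr _ := by simp
  rng_onArr _ := by simp
  map_unit _ := by simp
  map_mul _ _ _ := by simp
  conj_onOb _ := by simp
  conj_onArr _ := by simp

end StrictMor

/-- `p : A → B` admits continuous local sections around every point of `B`; in particular it is
surjective. -/
def IsLocallySplit {A B : Type u} [TopologicalSpace A] [TopologicalSpace B] (p : A → B) : Prop :=
  ∀ b : B, ∃ U : Set B, IsOpen U ∧ b ∈ U ∧ ∃ σ : U → A, Continuous σ ∧ ∀ x : U, p (σ x) = x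

/-- A Real generalized morphism `Γ.Ob ⟵ Z ⟶ G.Ob` from `Γ` to `G`: a locally compact Hausdorff
Real space `Z` with commuting Real actions of `Γ` on the left and of `G` on the right, such that
`rmap : Z → Γ.Ob` is a locally trivial principal Real `G`-bundle.  (Local triviality is a
consequence of `locallySplit` and `principal`, see `GenMor.exists_trivialization`.) -/
structure GenMor (Γ G : RealGroupoid.{u}) : Type (u + 1) where
  Z : Type u
  [top : TopologicalSpace Z]
  [t2 : T2Space Z]
  [lc : LocallyCompactSpace Z]
  conj : Z → Z
  conj_conj : ∀ z, conj (conj z) = z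
  continuous_conj : Continuous conj
  rmap : Z → Γ.Ob
  smap : Z → G.Ob
  continuous_rmap : Continuous rmap
  continuous_smap : Continuous smap
  rmap_conj : ∀ z, rmap (conj z) = Γ.conjOb (rmap z)
  smap_conj : ∀ z, smap (conj z) = G.conjOb (smap z)
  lact : (γ : Γ.Arr) → (z : Z) → Γ.src γ = rmap z → Z
  ract : (z : Z) → (g : G.Arr) → smap z = G.rng g → Z
  continuous_lact : Continuous fun p : {p : Γ.Arr × Z // Γ.src p.1 = rmap p.2} =>
    lact p.1.1 p.1.2 p.2
  continuous_ract : Continuous fun p : {p : Z × G.Arr // smap p.1 = G.rng p.2} =>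
    ract p.1.1 p.1.2 p.2
  rmap_lact : ∀ γ z e, rmap (lact γ z e) = Γ.rng γ
  smap_lact : ∀ γ z e, smap (lact γ z e) = smap z
  rmap_ract : ∀ z g e, rmap (ract z g e) = rmap z
  smap_ract : ∀ z g e, smap (ract z g e) = G.src g
  unit_lact : ∀ z, lact (Γ.unit (rmap z)) z (Γ.src_unit _) = z
  ract_unit : ∀ z, ract z (G.unit (smap z)) (G.rng_unit _).symm = z
  mul_lact : ∀ γ δ z (e₁ : Γ.src γ = Γ.rng δ) (e₂ : Γ.src δ = rmap z),
    lact (Γ.mul γ δ e₁) z ((Γ.src_mul γ δ e₁).trans e₂) =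
      lact γ (lact δ z e₂) (e₁.trans (rmap_lact δ z e₂).symm)
  ract_mul : ∀ z g h (e₁ : smap z = G.rng g) (e₂ : G.src g = G.rng h),
    ract z (G.mul g h e₂) (e₁.trans (G.rng_mul g h e₂).symm) =
      ract (ract z g e₁) h ((smap_ract z g e₁).trans e₂)
  lact_ract : ∀ γ z g (e₁ : Γ.src γ = rmap z) (e₂ : smap z = G.rng g),
    lact γ (ract z g e₂) (e₁.trans (rmap_ract z g e₂).symm) =
      ract (lact γ z e₁) g ((smap_lact γ z e₁).trans e₂)
  conj_lact : ∀ γ z (e : Γ.src γ = rmap z), conj (lact γ z e) =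
    lact (Γ.conjArr γ) (conj z) (by rw [Γ.src_conj, rmap_conj, e])
  conj_ract : ∀ z g (e : smap z = G.rng g), conj (ract z g e) =
    ract (conj z) (G.conjArr g) (by rw [G.rng_conj, smap_conj, e])
  locallySplit : IsLocallySplit rmap
  principal : IsHomeomorph fun p : {p : Z × G.Arr // smap p.1 = G.rng p.2} =>
    (⟨(p.1.1, ract p.1.1 p.1.2 p.2), (rmap_ract _ _ _).symm⟩ :
      {q : Z × Z // rmap q.1 = rmap q.2})

attribute [instance] GenMor.top GenMor.t2 GenMor.lc

attribute [simp] GenMor.conj_conj GenMor.rmap_conj GenMor.smap_conj GenMor.rmap_lact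
  GenMor.smap_lact GenMor.rmap_ract GenMor.smap_ract GenMor.unit_lact GenMor.ract_unit
  GenMor.conj_lact GenMor.conj_ract

lemma IsLocallySplit.continuous_of_comp {A B C : Type u} [TopologicalSpace A] [TopologicalSpace B]
    [TopologicalSpace C] {p : A → B} (hp : IsLocallySplit p) {f : B → C}
    (hf : Continuous (f ∘ p)) : Continuous f := by
  rw [continuous_iff_continuousAt]
  intro b
  obtain ⟨U, hU, hb, σ, hσ, hs⟩ := hp b
  refine ContinuousOn.continuousAt (s := U) ?_ (hU.mem_nhds hb)
  rw [continuousOn_iff_continuous_domRestrict]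
  have : U.domRestrict f = (f ∘ p) ∘ σ := by
    ext x; simp [hs x]
  rw [this]
  exact hf.comp hσ

/-- Constructor for the `principal` condition from a continuous division map. -/
lemma isHomeomorph_of_div {A B Y : Type u} [TopologicalSpace A] [TopologicalSpace B]
    {P : A → B → Prop} {act : (a : A) → (b : B) → P a b → A} {q : A → Y}
    (hq : ∀ a b h, q a = q (act a b h))
    (hact : Continuous fun p : {p : A × B // P p.1 p.2} => act p.1.1 p.1.2 p.2)
    (div : {p : A × A // q p.1 = q p.2} → B) (hdiv : Continuous div)
    (hP : ∀ p, P p.1.1 (div p)) (h1 : ∀ p, act p.1.1 (div p) (hP p) = p.1.2)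
    (h2 : ∀ a b (h : P a b), div ⟨(a, act a b h), hq a b h⟩ = b) :
    IsHomeomorph fun p : {p : A × B // P p.1 p.2} =>
      (⟨(p.1.1, act p.1.1 p.1.2 p.2), hq _ _ _⟩ : {p : A × A // q p.1 = q p.2}) := by
  let e : {p : A × B // P p.1 p.2} ≃ₜ {p : A × A // q p.1 = q p.2} :=
    { toFun := fun p => ⟨(p.1.1, act p.1.1 p.1.2 p.2), hq _ _ _⟩
      invFun := fun p => ⟨(p.1.1, div p), hP p⟩
      left_inv := fun p => by
        apply Subtype.ext; apply Prod.ext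
        · rfl
        · exact h2 _ _ p.2
      right_inv := fun p => by
        apply Subtype.ext; apply Prod.ext
        · rfl
        · exact h1 p
      continuous_toFun := by
        refine Continuous.subtype_mk (Continuous.prodMk ?_ hact) _
        fun_prop
      continuous_invFun := by
        refine Continuous.subtype_mk (Continuous.prodMk ?_ hdiv) _
        fun_prop }
  exact e.isHomeomorph

namespace GenMor

variable {Γ G H : RealGroupoid.{u}} (Z : GenMor Γ G)

lemma unit_lact' (y : Γ.Ob) (z : Z.Z) (e : Γ.src (Γ.unit y) = Z.rmap z) :
    Z.lact (Γ.unit y) z e = z := by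
  have : y = Z.rmap z := by simpa using e
  subst this; simp

lemma ract_unit' (x : G.Ob) (z : Z.Z) (e : Z.smap z = G.rng (G.unit x)) :
    Z.ract z (G.unit x) e = z := by
  have : x = Z.smap z := by simpa using e.symm
  subst this; simp

/-- For `z, w` in the same fibre of `rmap`, the unique arrow `g` with `z g = w`. -/
noncomputable def div (p : {p : Z.Z × Z.Z // Z.rmap p.1 = Z.rmap p.2}) : G.Arr :=
  (Z.principal.homeomorph.symm p).1.2

lemma continuous_div : Continuous Z.div :=
  continuous_snd.comp (continuous_subtype_val.comp Z.principal.homeomorph.symm.continuous)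

lemma div_spec (p : {p : Z.Z × Z.Z // Z.rmap p.1 = Z.rmap p.2}) :
    ∃ e : Z.smap p.1.1 = G.rng (Z.div p), Z.ract p.1.1 (Z.div p) e = p.1.2 := by
  have h := Z.principal.homeomorph.apply_symm_apply p
  have h1 : (Z.principal.homeomorph.symm p).1.1 = p.1.1 :=
    congrArg (fun q => q.1.1) h
  have h2 := congrArg (fun q => q.1.2) h
  have h3 := (Z.principal.homeomorph.symm p).2
  refine ⟨by rw [← h1]; exact h3, ?_⟩
  rw [← h2]
  simp only [IsHomeomorph.homeomorph_apply, div, h1]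

lemma ract_inj (z : Z.Z) (g h : G.Arr) (e₁ : Z.smap z = G.rng g) (e₂ : Z.smap z = G.rng h)
    (H : Z.ract z g e₁ = Z.ract z h e₂) : g = h := by
  have := @Z.principal.bijective.1 ⟨(z, g), e₁⟩ ⟨(z, h), e₂⟩ (by simp [H])
  simpa using this

lemma div_eq (z w : Z.Z) (h) (g : G.Arr) (e : Z.smap z = G.rng g) (H : Z.ract z g e = w) :
    Z.div ⟨(z, w), h⟩ = g := by
  obtain ⟨e', h'⟩ := Z.div_spec ⟨(z, w), h⟩
  exact Z.ract_inj z _ _ e' e (h'.trans H.symm)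

/-! Two consequences of the definition: local triviality, and openness of `rmap` for a groupoid
with open range map. -/

/-- Over a neighbourhood of any point, the principal bundle `rmap : Z → Γ.Ob` is equivariantly
homeomorphic to a trivial bundle `U ×_{φ, G.Ob, rng} G.Arr`. -/
lemma exists_trivialization (y : Γ.Ob) : ∃ (U : Set Γ.Ob) (_ : IsOpen U) (_ : y ∈ U)
    (φ : U → G.Ob) (_ : Continuous φ)
    (e : {z : Z.Z // Z.rmap z ∈ U} ≃ₜ {p : U × G.Arr // φ p.1 = G.rng p.2}),
    ∀ z, ((e z).1.1 : Γ.Ob) = Z.rmap z.1 ∧ ∃ hs : G.src (e z).1.2 = Z.smap z.1,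
      ∀ g (h : Z.smap z.1 = G.rng g),
        (e ⟨Z.ract z.1 g h, by rw [Z.rmap_ract]; exact z.2⟩).1.2 =
          G.mul (e z).1.2 g (hs.trans h) := by
  obtain ⟨U, hU, hy, σ, hσ, hs⟩ := Z.locallySplit y
  have e0 : ∀ z : {z : Z.Z // Z.rmap z ∈ U}, Z.rmap (σ ⟨_, z.2⟩) = Z.rmap z.1 := fun z => hs _
  have c0 : Continuous fun z : {z : Z.Z // Z.rmap z ∈ U} => (⟨Z.rmap z.1, z.2⟩ : U) :=
    Continuous.subtype_mk (Z.continuous_rmap.comp continuous_subtype_val) _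
  have hd := fun z : {z : Z.Z // Z.rmap z ∈ U} => Z.div_spec ⟨(σ ⟨_, z.2⟩, z.1), e0 z⟩
  let e : {z : Z.Z // Z.rmap z ∈ U} ≃ₜ {p : U × G.Arr // Z.smap (σ p.1) = G.rng p.2} :=
    { toFun := fun z => ⟨(⟨_, z.2⟩, Z.div ⟨(σ ⟨_, z.2⟩, z.1), e0 z⟩), (hd z).1⟩
      invFun := fun p => ⟨Z.ract (σ p.1.1) p.1.2 p.2, by
        rw [Z.rmap_ract, hs]; exact p.1.1.2⟩
      left_inv := fun z => Subtype.ext (hd z).2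
      right_inv := fun p => by
        have h1 : (⟨Z.rmap (Z.ract (σ p.1.1) p.1.2 p.2), by
            rw [Z.rmap_ract, hs]; exact p.1.1.2⟩ : U) = p.1.1 :=
          Subtype.ext ((Z.rmap_ract _ _ _).trans (hs _))
        apply Subtype.ext
        refine Prod.ext h1 (Z.div_eq _ _ _ _ ?_ ?_)
        · rw [h1]; exact p.2
        · simp only [h1]
      continuous_toFun := by
        exact Continuous.subtype_mk (c0.prodMk (Z.continuous_div.comp
          (Continuous.subtype_mk ((hσ.comp c0).prodMk continuous_subtype_val) _))) _
      continuous_invFun := by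
        refine Continuous.subtype_mk ?_ _
        exact Z.continuous_ract.comp (g := fun p : {p : Z.Z × G.Arr // Z.smap p.1 = G.rng p.2} =>
          Z.ract p.1.1 p.1.2 p.2) (Continuous.subtype_mk (f := fun p : {p : U × G.Arr //
            Z.smap (σ p.1) = G.rng p.2} => (σ p.1.1, p.1.2))
            ((hσ.comp (by fun_prop)).prodMk (by fun_prop)) fun p => p.2) }
  have hsrc : ∀ z, G.src (e z).1.2 = Z.smap z.1 := fun z => by
    exact (Z.smap_ract _ _ (hd z).1).symm.trans (congrArg Z.smap (hd z).2)
  refine ⟨U, hU, hy, fun x => Z.smap (σ x), Z.continuous_smap.comp hσ, e, fun z =>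
    ⟨rfl, hsrc z, fun g h => ?_⟩⟩
  have h1 : (⟨Z.rmap (Z.ract z.1 g h), by rw [Z.rmap_ract]; exact z.2⟩ : U) = ⟨_, z.2⟩ :=
    Subtype.ext (Z.rmap_ract _ _ _)
  refine Z.div_eq _ _ _ _ ?_ ?_
  · rw [h1, G.rng_mul]; exact (hd z).1
  · simp only [h1]
    refine (Z.ract_mul _ _ _ (hd z).1 ((hsrc z).trans h)).trans ?_
    congr 1
    exact (hd z).2

lemma isOpenMap_rmap (hG : IsOpenMap G.rng) : IsOpenMap Z.rmap := by
  intro O hO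
  rw [isOpen_iff_mem_nhds]
  rintro _ ⟨z, hz, rfl⟩
  obtain ⟨U, hU, hy, φ, hφ, e, he⟩ := Z.exists_trivialization (Z.rmap z)
  have h1 : IsOpen (e '' (Subtype.val ⁻¹' O)) :=
    e.isOpenMap _ (hO.preimage continuous_subtype_val)
  obtain ⟨N, hN, hN'⟩ := isOpen_induced_iff.1 h1
  have hzN : (e ⟨z, hy⟩).1 ∈ N := by
    have : e ⟨z, hy⟩ ∈ Subtype.val ⁻¹' N := by
      rw [hN']; exact ⟨_, hz, rfl⟩
    exact this
  obtain ⟨A, B, hA, hB, hzA, hzB, hAB⟩ := isOpen_prod_iff.1 hN _ _ hzN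
  have h2 : IsOpen (Subtype.val '' (A ∩ φ ⁻¹' (G.rng '' B)) : Set Γ.Ob) :=
    hU.isOpenMap_subtype_val _ (hA.inter ((hG _ hB).preimage hφ))
  refine Filter.mem_of_superset (h2.mem_nhds ⟨_, ⟨hzA, _, hzB, (e ⟨z, hy⟩).2.symm⟩,
    (he ⟨z, hy⟩).1⟩) ?_
  rintro _ ⟨x, ⟨hxA, g, hg, hx⟩, rfl⟩
  have h3 : (⟨(x, g), hx.symm⟩ : {p : U × G.Arr // φ p.1 = G.rng p.2}) ∈
      e '' (Subtype.val ⁻¹' O) := by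
    rw [← hN']; exact hAB ⟨hxA, hg⟩
  obtain ⟨w, hw, hw'⟩ := h3
  refine ⟨w.1, hw, ?_⟩
  rw [← (he w).1, hw']

end GenMor

namespace GenMor

variable {Γ G H : RealGroupoid.{u}}

lemma rng_div (Z : GenMor Γ G) (p) : Z.smap p.1.1 = G.rng (Z.div p) := (Z.div_spec p).1

lemma ract_div (Z : GenMor Γ G) (p) : Z.ract p.1.1 (Z.div p) (Z.rng_div p) = p.1.2 :=
  (Z.div_spec p).2

lemma src_div (Z : GenMor Γ G) (p) : G.src (Z.div p) = Z.smap p.1.2 := by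
  rw [← Z.smap_ract _ _ (Z.rng_div p), Z.ract_div]

@[simp] lemma inv_lact_lact (Z : GenMor Γ G) (γ z) (e : Γ.src γ = Z.rmap z)
    (e' : Γ.src (Γ.inv γ) = Z.rmap (Z.lact γ z e)) :
    Z.lact (Γ.inv γ) (Z.lact γ z e) e' = z := by
  rw [← Z.mul_lact _ _ _ (by simp) e]; simp [unit_lact']

@[simp] lemma lact_inv_lact (Z : GenMor Γ G) (γ z) (e : Γ.src (Γ.inv γ) = Z.rmap z)
    (e' : Γ.src γ = Z.rmap (Z.lact (Γ.inv γ) z e)) :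
    Z.lact γ (Z.lact (Γ.inv γ) z e) e' = z := by
  rw [← Z.mul_lact _ _ _ (by simp) e]; simp [unit_lact']

@[simp] lemma ract_ract_inv (Z : GenMor Γ G) (g z) (e : Z.smap z = G.rng g)
    (e' : Z.smap (Z.ract z g e) = G.rng (G.inv g)) :
    Z.ract (Z.ract z g e) (G.inv g) e' = z := by
  rw [← Z.ract_mul _ _ _ e (by simp)]; simp [ract_unit']

@[simp] lemma ract_inv_ract (Z : GenMor Γ G) (g z) (e : Z.smap z = G.rng (G.inv g))
    (e' : Z.smap (Z.ract z (G.inv g) e) = G.rng g) :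
    Z.ract (Z.ract z (G.inv g) e) g e' = z := by
  rw [← Z.ract_mul _ _ _ e (by simp)]; simp [ract_unit']

/-! ### Composition -/

variable (Z : GenMor Γ G) (W : GenMor G H)

/-- The fibre product `Z ×_{G.Ob} W`. -/
abbrev CompPt : Type u := {p : Z.Z × W.Z // Z.smap p.1 = W.rmap p.2}

/-- The relation `(z, w) ∼ (z g, g⁻¹ w)` on `Z ×_{G.Ob} W`. -/
def compSetoid : Setoid (CompPt Z W) where
  r p q := ∃ (g : G.Arr) (e : Z.smap p.1.1 = G.rng g),
    q.1.1 = Z.ract p.1.1 g e ∧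
      q.1.2 = W.lact (G.inv g) p.1.2 ((G.src_inv g).trans (e.symm.trans p.2))
  iseqv :=
    { refl := fun p => ⟨G.unit (Z.smap p.1.1), by simp, by simp, by
        simp only [RealGroupoid.inv_unit, unit_lact']⟩
      symm := by
        rintro ⟨⟨z, w⟩, hp⟩ ⟨⟨z', w'⟩, hq⟩ ⟨g, e, h1, h2⟩
        simp only at h1 h2
        subst h1 h2
        refine ⟨G.inv g, by simp, ?_, ?_⟩
        · simp
        · simp only [RealGroupoid.inv_inv, lact_inv_lact]
      trans := by
        rintro ⟨⟨z, w⟩, hp⟩ ⟨⟨z', w'⟩, hq⟩ ⟨⟨z'', w''⟩, hr⟩ ⟨g, e, h1, h2⟩ ⟨g', e', h1', h2'⟩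
        simp only at h1 h2 h1' h2' e e'
        subst h1 h2 h1' h2'
        have e3 : G.src g = G.rng g' := by simpa using e'
        refine ⟨G.mul g g' e3, by simpa using e, ?_, ?_⟩
        · simp only [Z.ract_mul _ _ _ e e3]
        · simp only [G.inv_mul_rev _ _ e3]
          rw [W.mul_lact] }

/-- The quotient `Z ×_G W` of the fibre product by `(z, w) ∼ (z g, g⁻¹ w)`. -/
abbrev CompQuot : Type u := Quotient (compSetoid Z W)

variable {Z W}

/-- The class `[z, w]` in `Z ×_G W`. -/
abbrev compMk (p : CompPt Z W) : CompQuot Z W := Quotient.mk (compSetoid Z W) p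

lemma compMk_eq {p q : CompPt Z W} (g : G.Arr) (e : Z.smap p.1.1 = G.rng g)
    (h1 : q.1.1 = Z.ract p.1.1 g e) (h2 : p.1.2 = W.lact g q.1.2 (by
      rw [← q.2, h1, Z.smap_ract])) : compMk p = compMk q := by
  refine Quotient.sound ⟨g, e, h1, ?_⟩
  simp only [h2, inv_lact_lact]

lemma continuous_compMk : Continuous (compMk : CompPt Z W → CompQuot Z W) := continuous_quot_mk

variable (Z W)

def compRmap : CompQuot Z W → Γ.Ob :=
  Quotient.lift (fun p => Z.rmap p.1.1) (by
    rintro p q ⟨g, e, h1, h2⟩; simp [h1])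

def compSmap : CompQuot Z W → H.Ob :=
  Quotient.lift (fun p => W.smap p.1.2) (by
    rintro p q ⟨g, e, h1, h2⟩; simp [h2])

def compConj : CompQuot Z W → CompQuot Z W :=
  Quotient.lift (fun p => compMk ⟨(Z.conj p.1.1, W.conj p.1.2), by simp [p.2]⟩) (by
    rintro p q ⟨g, e, h1, h2⟩
    exact Quotient.sound ⟨G.conjArr g, by simp [e], by simp [h1], by simp [h2]⟩)

def compLact (γ : Γ.Arr) (c : CompQuot Z W) (hc : Γ.src γ = compRmap Z W c) : CompQuot Z W :=
  Quotient.pliftOn c (fun p hp => compMk ⟨(Z.lact γ p.1.1 (by rw [hc, hp]; rfl), p.1.2), by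
    simp [p.2]⟩) (by
    rintro p q hp hq ⟨g, e, h1, h2⟩
    exact Quotient.sound ⟨g, by simpa using e, by
      simp only [h1]; exact Z.lact_ract _ _ _ _ _, by simp only [h2]⟩)

def compRact (c : CompQuot Z W) (h : H.Arr) (hc : compSmap Z W c = H.rng h) : CompQuot Z W :=
  Quotient.pliftOn c (fun p hp => compMk ⟨(p.1.1, W.ract p.1.2 h (by rw [← hc, hp]; rfl)), by
    simp [p.2]⟩) (by
    rintro p q hp hq ⟨g, e, h1, h2⟩
    exact Quotient.sound ⟨g, e, by simp [h1], by
      simp only [h2]; exact (W.lact_ract _ _ _ _ _).symm⟩)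

variable {Z W}

@[simp] lemma compRmap_mk (p : CompPt Z W) : compRmap Z W (compMk p) = Z.rmap p.1.1 := rfl
@[simp] lemma compSmap_mk (p : CompPt Z W) : compSmap Z W (compMk p) = W.smap p.1.2 := rfl

lemma continuous_compRmap : Continuous (compRmap Z W) :=
  continuous_quot_lift _ (Z.continuous_rmap.comp (by fun_prop))

lemma continuous_compSmap : Continuous (compSmap Z W) :=
  continuous_quot_lift _ (W.continuous_smap.comp (by fun_prop))

section localSection

variable {U : Set Γ.Ob} (σ : U → Z.Z) (hs : ∀ x, Z.rmap (σ x) = x)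

/-- In the class `c` over `y ∈ U` there is a unique representative of the form `(σ y, w)`. -/
noncomputable def compLift (c : compRmap Z W ⁻¹' U) : CompPt Z W :=
  Quotient.pliftOn c.1 (fun p hp =>
    have hU : Z.rmap p.1.1 ∈ U := by
      have := c.2
      rw [Set.mem_preimage, hp] at this
      exact this
    let d := Z.div ⟨(σ ⟨_, hU⟩, p.1.1), hs _⟩
    ⟨(σ ⟨_, hU⟩, W.lact d p.1.2 ((Z.src_div _).trans p.2)), by
      rw [W.rmap_lact]; exact Z.rng_div ⟨(σ ⟨_, hU⟩, p.1.1), hs _⟩⟩) (by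
    rintro ⟨⟨z, w⟩, hzw⟩ ⟨⟨z', w'⟩, hq⟩ hp hq' ⟨g, e, h1, h2⟩
    simp only at h1 h2
    subst h1 h2
    apply Subtype.ext
    simp only [Prod.mk.injEq, rmap_ract, true_and]
    have hU : Z.rmap z ∈ U := by
      have := c.2
      rw [Set.mem_preimage, hp] at this
      exact this
    have e0 : Z.smap (σ ⟨_, hU⟩) = G.rng (Z.div ⟨(σ ⟨_, hU⟩, z), hs _⟩) :=
      Z.rng_div ⟨(σ ⟨_, hU⟩, z), hs _⟩
    have e1 : G.src (Z.div ⟨(σ ⟨_, hU⟩, z), hs _⟩) = G.rng g := by rw [Z.src_div]; exact e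
    have key : Z.div ⟨(σ ⟨_, hU⟩, Z.ract z g e), (hs _).trans (Z.rmap_ract _ _ _).symm⟩ =
        G.mul (Z.div ⟨(σ ⟨_, hU⟩, z), hs _⟩) g e1 := by
      apply Z.div_eq _ _ _ _ (by simpa using e0)
      rw [Z.ract_mul _ _ _ e0 e1]
      congr 1
      exact Z.ract_div ⟨(σ ⟨_, hU⟩, z), hs _⟩
    simp only [key]
    rw [W.mul_lact _ _ _ e1 (by simp)]
    simp only [lact_inv_lact])

lemma compMk_compLift (c : compRmap Z W ⁻¹' U) : compMk (compLift σ hs c) = c.1 := by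
  obtain ⟨c, hc⟩ := c
  induction c using Quotient.inductionOn with
  | h p =>
    refine compMk_eq (Z.div ⟨(σ ⟨_, hc⟩, p.1.1), hs _⟩) ?_ ?_ ?_
    · exact Z.rng_div ⟨(σ ⟨_, hc⟩, p.1.1), hs _⟩
    · exact (Z.ract_div ⟨(σ ⟨_, hc⟩, p.1.1), hs _⟩).symm
    · rfl

lemma continuous_compLift (hU : IsOpen U) (hσ : Continuous σ) :
    Continuous (compLift (W := W) σ hs) := by
  have hq : Topology.IsQuotientMap (compMk : CompPt Z W → CompQuot Z W) :=
    isQuotientMap_quotient_mk'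
  rw [(hq.restrictPreimage_isOpen (hU.preimage continuous_compRmap)).continuous_iff]
  have c1 : Continuous fun x : compMk ⁻¹' (compRmap Z W ⁻¹' U) =>
      σ ⟨Z.rmap x.1.1.1, x.2⟩ := by
    refine hσ.comp (Continuous.subtype_mk (Z.continuous_rmap.comp (by fun_prop)) _)
  have c2 : Continuous fun x : compMk ⁻¹' (compRmap Z W ⁻¹' U) =>
      Z.div ⟨(σ ⟨Z.rmap x.1.1.1, x.2⟩, x.1.1.1), hs _⟩ := by
    refine Z.continuous_div.comp (Continuous.subtype_mk (c1.prodMk (by fun_prop)) _)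
  refine Continuous.subtype_mk (c1.prodMk ?_) _
  have e3 : ∀ x : compMk ⁻¹' (compRmap Z W ⁻¹' U),
      G.src (Z.div ⟨(σ ⟨Z.rmap x.1.1.1, x.2⟩, x.1.1.1), hs _⟩) = W.rmap x.1.1.2 :=
    fun x => (Z.src_div _).trans x.1.2
  have c4 : Continuous fun x : compMk ⁻¹' (compRmap Z W ⁻¹' U) =>
      (⟨(Z.div ⟨(σ ⟨Z.rmap x.1.1.1, x.2⟩, x.1.1.1), hs _⟩, x.1.1.2), e3 x⟩ :
        {p : G.Arr × W.Z // G.src p.1 = W.rmap p.2}) :=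
    Continuous.subtype_mk (c2.prodMk (continuous_snd.comp
      (continuous_subtype_val.comp continuous_subtype_val))) _
  exact W.continuous_lact.comp c4

end localSection

lemma compMk_split : IsLocallySplit (compMk : CompPt Z W → CompQuot Z W) := by
  intro c
  obtain ⟨U, hU, hc, σ, hσ, hs⟩ := Z.locallySplit (compRmap Z W c)
  exact ⟨_, hU.preimage continuous_compRmap, hc, compLift σ hs, continuous_compLift σ hs hU hσ,
    compMk_compLift σ hs⟩

instance : T2Space (CompQuot Z W) := by
  refine ⟨fun a b hab => ?_⟩
  by_cases h : compRmap Z W a = compRmap Z W b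
  · obtain ⟨U, hU, hc, σ, hσ, hs⟩ := Z.locallySplit (compRmap Z W a)
    have hb : b ∈ compRmap Z W ⁻¹' U := by
      rw [Set.mem_preimage, ← h]; exact hc
    have hne : compLift (W := W) σ hs ⟨a, hc⟩ ≠ compLift σ hs ⟨b, hb⟩ := by
      intro h'
      have := congrArg compMk h'
      rw [compMk_compLift, compMk_compLift] at this
      exact hab this
    obtain ⟨A, B, hA, hB, ha', hb', hd⟩ := t2_separation hne
    have hO := hU.preimage (continuous_compRmap (Z := Z) (W := W))
    have hcont := continuous_compLift (W := W) σ hs hU hσ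
    refine ⟨_, _, hO.isOpenMap_subtype_val _ (hA.preimage hcont),
      hO.isOpenMap_subtype_val _ (hB.preimage hcont), ⟨⟨a, hc⟩, ha', rfl⟩, ⟨⟨b, hb⟩, hb', rfl⟩, ?_⟩
    rw [Set.disjoint_image_iff Subtype.val_injective]
    exact hd.preimage _
  · obtain ⟨A, B, hA, hB, ha', hb', hd⟩ := t2_separation h
    exact ⟨_, _, hA.preimage continuous_compRmap, hB.preimage continuous_compRmap, ha', hb',
      hd.preimage _⟩

instance : LocallyCompactSpace (CompQuot Z W) := by
  suffices WeaklyLocallyCompactSpace (CompQuot Z W) from inferInstance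
  refine ⟨fun c => ?_⟩
  obtain ⟨U, hU, hc, σ, hσ, hs⟩ := Z.locallySplit (compRmap Z W c)
  have hO := hU.preimage (continuous_compRmap (Z := Z) (W := W))
  have hcont := continuous_compLift (W := W) σ hs hU hσ
  have : LocallyCompactSpace U := hU.locallyCompactSpace
  let c0 : compRmap Z W ⁻¹' U := ⟨c, hc⟩
  obtain ⟨K, hK, hK'⟩ := exists_compact_mem_nhds (⟨_, hc⟩ : U)
  obtain ⟨L, hL, hL'⟩ := exists_compact_mem_nhds (compLift (W := W) σ hs c0).1.2
  let T : Type u := {p : U × W.Z // Z.smap (σ p.1) = W.rmap p.2}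
  let m : T → CompQuot Z W := fun p => compMk ⟨(σ p.1.1, p.1.2), p.2⟩
  have hm : Continuous m := continuous_compMk.comp
    (Continuous.subtype_mk ((hσ.comp (by fun_prop)).prodMk (by fun_prop)) _)
  have hcl : IsClosed {p : U × W.Z | Z.smap (σ p.1) = W.rmap p.2} :=
    isClosed_eq (Z.continuous_smap.comp (hσ.comp continuous_fst))
      (W.continuous_rmap.comp continuous_snd)
  have hKL : IsCompact ((Subtype.val : T → U × W.Z) ⁻¹' (K ×ˢ L)) :=
    hcl.isClosedEmbedding_subtypeVal.isCompact_preimage (hK.prod hL)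
  refine ⟨m '' _, hKL.image hm, ?_⟩
  let P : compRmap Z W ⁻¹' U → U × W.Z := fun x => (⟨_, x.2⟩, (compLift (W := W) σ hs x).1.2)
  have hP : Continuous P := by
    refine Continuous.prodMk (Continuous.subtype_mk
      (continuous_compRmap.comp continuous_subtype_val) _) ?_
    exact continuous_snd.comp (continuous_subtype_val.comp hcont)
  have h1 : P ⁻¹' (K ×ˢ L) ∈ nhds c0 := hP.continuousAt (prod_mem_nhds hK' hL')
  have h2 := hO.isOpenMap_subtype_val.image_mem_nhds h1
  refine Filter.mem_of_superset h2 ?_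
  rintro _ ⟨x, hx, rfl⟩
  have hx1 : (compLift (W := W) σ hs x).1.1 = σ ⟨_, x.2⟩ := by
    obtain ⟨x, hx'⟩ := x
    induction x using Quotient.inductionOn with
    | h p => rfl
  refine ⟨⟨P x, ?_⟩, hx, ?_⟩
  · have := (compLift (W := W) σ hs x).2
    rw [hx1] at this
    exact this
  · conv_rhs => rw [← compMk_compLift (W := W) σ hs x]
    simp only [m, P]
    congr 1
    apply Subtype.ext
    exact Prod.ext hx1.symm rfl

end GenMor

lemma IsLocallySplit.continuous_of_pullback {A B C P : Type u} [TopologicalSpace A]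
    [TopologicalSpace B] [TopologicalSpace C] [TopologicalSpace P] {q : P → B}
    (hq : IsLocallySplit q) {a : A → B} (ha : Continuous a) {F : A → C}
    (hF : Continuous fun x : {x : A × P // a x.1 = q x.2} => F x.1.1) : Continuous F := by
  refine IsLocallySplit.continuous_of_comp
    (p := fun x : {x : A × P // a x.1 = q x.2} => x.1.1) (fun x => ?_) hF
  obtain ⟨U, hU, hx, σ, hσ, hs⟩ := hq (a x)
  refine ⟨a ⁻¹' U, hU.preimage ha, hx, fun y => ⟨(y.1, σ ⟨a y.1, y.2⟩), (hs ⟨a y.1, y.2⟩).symm⟩, ?_,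
    fun y => rfl⟩
  refine Continuous.subtype_mk (continuous_subtype_val.prodMk (hσ.comp ?_)) _
  exact Continuous.subtype_mk (ha.comp continuous_subtype_val) _

namespace GenMor

variable {Γ G H : RealGroupoid.{u}}

section

variable (Z : GenMor Γ G) {A : Type u} [TopologicalSpace A]

lemma continuous_lact' {f : A → Γ.Arr} {h : A → Z.Z} (hf : Continuous f) (hh : Continuous h)
    (e : ∀ a, Γ.src (f a) = Z.rmap (h a)) : Continuous fun a => Z.lact (f a) (h a) (e a) :=
  Z.continuous_lact.comp (g := fun p : {p : Γ.Arr × Z.Z // Γ.src p.1 = Z.rmap p.2} =>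
    Z.lact p.1.1 p.1.2 p.2) (Continuous.subtype_mk (hf.prodMk hh) e)

lemma continuous_ract' {f : A → Z.Z} {h : A → G.Arr} (hf : Continuous f) (hh : Continuous h)
    (e : ∀ a, Z.smap (f a) = G.rng (h a)) : Continuous fun a => Z.ract (f a) (h a) (e a) :=
  Z.continuous_ract.comp (g := fun p : {p : Z.Z × G.Arr // Z.smap p.1 = G.rng p.2} =>
    Z.ract p.1.1 p.1.2 p.2) (Continuous.subtype_mk (hf.prodMk hh) e)

lemma continuous_div' {f h : A → Z.Z} (hf : Continuous f) (hh : Continuous h)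
    (e : ∀ a, Z.rmap (f a) = Z.rmap (h a)) : Continuous fun a => Z.div ⟨(f a, h a), e a⟩ :=
  Z.continuous_div.comp (Continuous.subtype_mk (hf.prodMk hh) e)

end

variable {Z : GenMor Γ G} {W : GenMor G H}

@[simp] lemma compLact_mk (γ : Γ.Arr) (p : CompPt Z W)
    (e : Γ.src γ = compRmap Z W (compMk p)) :
    compLact Z W γ (compMk p) e = compMk ⟨(Z.lact γ p.1.1 e, p.1.2),
      (Z.smap_lact _ _ _).trans p.2⟩ := rfl

@[simp] lemma compRact_mk (p : CompPt Z W) (h : H.Arr)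
    (e : compSmap Z W (compMk p) = H.rng h) :
    compRact Z W (compMk p) h e = compMk ⟨(p.1.1, W.ract p.1.2 h e),
      p.2.trans (W.rmap_ract _ _ _).symm⟩ := rfl

/-- The arrow dividing `[q]` by `[p]` in `Z ×_G W`. -/
noncomputable def compDiv (p q : CompPt Z W) (e : Z.rmap p.1.1 = Z.rmap q.1.1) : H.Arr :=
  W.div ⟨(p.1.2, W.lact (Z.div ⟨(p.1.1, q.1.1), e⟩) q.1.2 ((Z.src_div _).trans q.2)), by
    rw [W.rmap_lact, ← p.2]; exact Z.rng_div ⟨(p.1.1, q.1.1), e⟩⟩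

lemma compRact_compDiv (p q : CompPt Z W) (e : Z.rmap p.1.1 = Z.rmap q.1.1) :
    ∃ e', compRact Z W (compMk p) (compDiv p q e) e' = compMk q := by
  refine ⟨W.rng_div ⟨(p.1.2, W.lact _ q.1.2 _), _⟩, ?_⟩
  refine compMk_eq (Z.div ⟨(p.1.1, q.1.1), e⟩) (Z.rng_div ⟨(p.1.1, q.1.1), e⟩)
    (Z.ract_div ⟨(p.1.1, q.1.1), e⟩).symm ?_
  exact W.ract_div ⟨(p.1.2, W.lact _ q.1.2 _), _⟩

lemma compRact_inj (c : CompQuot Z W) (h h' : H.Arr) (e : compSmap Z W c = H.rng h)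
    (e' : compSmap Z W c = H.rng h') (E : compRact Z W c h e = compRact Z W c h' e') :
    h = h' := by
  induction c using Quotient.inductionOn with
  | h p =>
    obtain ⟨⟨z, w⟩, hp⟩ := p
    obtain ⟨g, e1, h1, h2⟩ := Quotient.exact E
    simp only at h1 h2 e1
    have hg : G.unit (Z.smap z) = g :=
      Z.ract_inj z _ _ (by simp) e1 (by rw [← h1, Z.ract_unit])
    subst hg
    simp only [RealGroupoid.inv_unit, unit_lact'] at h2
    exact (W.ract_inj w _ _ _ _ h2).symm

lemma comp_exists_div (p : {p : CompQuot Z W × CompQuot Z W //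
    compRmap Z W p.1 = compRmap Z W p.2}) :
    ∃ (h : H.Arr) (e : _), compRact Z W p.1.1 h e = p.1.2 := by
  obtain ⟨⟨a, b⟩, e⟩ := p
  induction a using Quotient.inductionOn with
  | h p =>
    induction b using Quotient.inductionOn with
    | h q => exact ⟨_, compRact_compDiv p q e⟩

lemma continuous_compRact : Continuous fun p : {p : CompQuot Z W × H.Arr //
    compSmap Z W p.1 = H.rng p.2} => compRact Z W p.1.1 p.1.2 p.2 := by
  refine (compMk_split (Z := Z) (W := W)).continuous_of_pullback (a := fun p : {p : CompQuot Z W × H.Arr //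
    compSmap Z W p.1 = H.rng p.2} => p.1.1)
    (by fun_prop) ?_
  have : ∀ x : {x : {p : CompQuot Z W × H.Arr // compSmap Z W p.1 = H.rng p.2} × CompPt Z W //
      x.1.1.1 = compMk x.2}, W.smap x.1.2.1.2 = H.rng x.1.1.1.2 := by
    rintro ⟨⟨⟨⟨c, h⟩, e⟩, p⟩, E⟩
    change c = compMk p at E
    subst E; exact e
  have hc : Continuous fun x : {x : {p : CompQuot Z W × H.Arr //
      compSmap Z W p.1 = H.rng p.2} × CompPt Z W // x.1.1.1 = compMk x.2} =>
      compMk (Z := Z) (W := W) ⟨(x.1.2.1.1, W.ract x.1.2.1.2 x.1.1.1.2 (this x)), by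
        simp [x.1.2.2]⟩ := by
    refine continuous_compMk.comp (Continuous.subtype_mk (Continuous.prodMk (by fun_prop) ?_) _)
    exact W.continuous_ract' (by fun_prop) (by fun_prop) _
  convert hc using 2 with x
  obtain ⟨⟨⟨⟨c, h⟩, e⟩, p⟩, E⟩ := x
  change c = compMk p at E
  subst E; rfl

lemma continuous_compLact : Continuous fun p : {p : Γ.Arr × CompQuot Z W //
    Γ.src p.1 = compRmap Z W p.2} => compLact Z W p.1.1 p.1.2 p.2 := by
  refine (compMk_split (Z := Z) (W := W)).continuous_of_pullback (a := fun p : {p : Γ.Arr × CompQuot Z W //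
    Γ.src p.1 = compRmap Z W p.2} => p.1.2)
    (by fun_prop) ?_
  have : ∀ x : {x : {p : Γ.Arr × CompQuot Z W // Γ.src p.1 = compRmap Z W p.2} × CompPt Z W //
      x.1.1.2 = compMk x.2}, Γ.src x.1.1.1.1 = Z.rmap x.1.2.1.1 := by
    rintro ⟨⟨⟨⟨h, c⟩, e⟩, p⟩, E⟩
    change c = compMk p at E
    subst E; exact e
  have hc : Continuous fun x : {x : {p : Γ.Arr × CompQuot Z W //
      Γ.src p.1 = compRmap Z W p.2} × CompPt Z W // x.1.1.2 = compMk x.2} =>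
      compMk (Z := Z) (W := W) ⟨(Z.lact x.1.1.1.1 x.1.2.1.1 (this x), x.1.2.1.2), by
        simp [x.1.2.2]⟩ := by
    refine continuous_compMk.comp (Continuous.subtype_mk (Continuous.prodMk ?_ (by fun_prop)) _)
    exact Z.continuous_lact' (by fun_prop) (by fun_prop) _
  convert hc using 2 with x
  obtain ⟨⟨⟨⟨h, c⟩, e⟩, p⟩, E⟩ := x
  change c = compMk p at E
  subst E; rfl

lemma compRmap_compRact (c : CompQuot Z W) (h : H.Arr) (e : compSmap Z W c = H.rng h) :
    compRmap Z W (compRact Z W c h e) = compRmap Z W c := by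
  induction c using Quotient.inductionOn with
  | h p => rfl

lemma comp_principal : IsHomeomorph fun p : {p : CompQuot Z W × H.Arr //
    compSmap Z W p.1 = H.rng p.2} =>
    (⟨(p.1.1, compRact Z W p.1.1 p.1.2 p.2), (compRmap_compRact p.1.1 p.1.2 p.2).symm⟩ :
      {q : CompQuot Z W × CompQuot Z W // compRmap Z W q.1 = compRmap Z W q.2}) := by
  refine isHomeomorph_of_div (P := fun c h => compSmap Z W c = H.rng h) (act := compRact Z W)
    (q := compRmap Z W) (fun a b h => (compRmap_compRact a b h).symm) continuous_compRact
    (fun p => (comp_exists_div p).choose) ?_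
    (fun p => (comp_exists_div p).choose_spec.choose)
    (fun p => (comp_exists_div p).choose_spec.choose_spec) ?_
  · refine (compMk_split (Z := Z) (W := W)).continuous_of_pullback (a := fun p : {q : CompQuot Z W × CompQuot Z W // compRmap Z W q.1 = compRmap Z W q.2} =>
        p.1.1)
      (by fun_prop) ?_
    refine (compMk_split (Z := Z) (W := W)).continuous_of_pullback (a := fun p : {x : {p : CompQuot Z W × CompQuot Z W //
        compRmap Z W p.1 = compRmap Z W p.2} × CompPt Z W // x.1.1.1 = compMk x.2} => p.1.1.1.2)
      (by fun_prop) ?_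
    have this : ∀ x : {x : {x : {p : CompQuot Z W × CompQuot Z W //
        compRmap Z W p.1 = compRmap Z W p.2} × CompPt Z W // x.1.1.1 = compMk x.2} × CompPt Z W //
        x.1.1.1.1.2 = compMk x.2}, Z.rmap x.1.1.1.2.1.1 = Z.rmap x.1.2.1.1 := by
      rintro ⟨⟨⟨⟨⟨⟨a, b⟩, e⟩, p⟩, E⟩, q⟩, hq⟩
      change a = compMk p at E
      subst E
      change b = compMk q at hq
      subst hq
      exact e
    have hc : Continuous fun x : {x : {x : {p : CompQuot Z W × CompQuot Z W //
        compRmap Z W p.1 = compRmap Z W p.2} × CompPt Z W // x.1.1.1 = compMk x.2} × CompPt Z W //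
        x.1.1.1.1.2 = compMk x.2} => compDiv x.1.1.1.2 x.1.2 (this x) := by
      refine W.continuous_div' (by fun_prop) (W.continuous_lact' ?_ (by fun_prop) _) _
      exact Z.continuous_div' (by fun_prop) (by fun_prop) _
    convert hc using 2 with x
    have hx := this x
    obtain ⟨⟨⟨⟨⟨⟨a, b⟩, e⟩, p⟩, E⟩, q⟩, hq⟩ := x
    change a = compMk p at E
    subst E
    change b = compMk q at hq
    subst hq
    have h1 := comp_exists_div ⟨(compMk p, compMk q), e⟩
    obtain ⟨e', h2⟩ := compRact_compDiv p q hx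
    exact compRact_inj (compMk p) _ _ h1.choose_spec.choose e'
      (h1.choose_spec.choose_spec.trans h2.symm)
  · intro a b h
    have h1 := comp_exists_div ⟨(a, compRact Z W a b h), (compRmap_compRact a b h).symm⟩
    exact compRact_inj a _ _ h1.choose_spec.choose h h1.choose_spec.choose_spec

lemma comp_split : IsLocallySplit (compRmap Z W) := by
  intro y
  obtain ⟨U, hU, hy, σ, hσ, hs⟩ := Z.locallySplit y
  obtain ⟨V, hV, hy', σ', hσ', hs'⟩ := W.locallySplit (Z.smap (σ ⟨y, hy⟩))
  have hV' : IsOpen ((fun x : U => Z.smap (σ x)) ⁻¹' V) :=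
    hV.preimage (Z.continuous_smap.comp hσ)
  have hm : ∀ x : ((Subtype.val : U → Γ.Ob) '' ((fun x : U => Z.smap (σ x)) ⁻¹' V)),
      ∃ h : x.1 ∈ U, Z.smap (σ ⟨x.1, h⟩) ∈ V := by
    rintro ⟨_, ⟨x, hx, rfl⟩⟩
    exact ⟨x.2, hx⟩
  refine ⟨Subtype.val '' ((fun x : U => Z.smap (σ x)) ⁻¹' V), hU.isOpenMap_subtype_val _ hV',
    ⟨⟨y, hy⟩, hy', rfl⟩, fun x => compMk ⟨(σ ⟨x.1, (hm x).1⟩, σ' ⟨_, (hm x).2⟩),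
      (hs' ⟨_, (hm x).2⟩).symm⟩, ?_, fun x => hs _⟩
  have c1 : Continuous fun x : ((Subtype.val : U → Γ.Ob) '' ((fun x : U => Z.smap (σ x)) ⁻¹' V)) =>
      σ ⟨x.1, (hm x).1⟩ := hσ.comp (Continuous.subtype_mk continuous_subtype_val _)
  refine continuous_compMk.comp (Continuous.subtype_mk (c1.prodMk (hσ'.comp ?_)) _)
  exact Continuous.subtype_mk (Z.continuous_smap.comp c1) _

/-- The composite `W ∘ Z = Z ×_G W` of generalized morphisms `Z` from `Γ` to `G` and `W` from `G`
to `H`: the quotient of `Z ×_{G.Ob} W` by `(z, w) ∼ (z g, g⁻¹ w)`, with `rmap [z, w] = rmap z`,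
`smap [z, w] = smap w`, `γ [z, w] = [γ z, w]`, `[z, w] h = [z, w h]` and the involution
`[z, w] ↦ [conj z, conj w]`. -/
def comp (Z : GenMor Γ G) (W : GenMor G H) : GenMor Γ H where
  Z := CompQuot Z W
  conj := compConj Z W
  conj_conj c := by
    induction c using Quotient.inductionOn with
    | h p => simp [compConj]
  continuous_conj := by
    refine continuous_quot_lift _ (continuous_compMk.comp (Continuous.subtype_mk
      (Continuous.prodMk (Z.continuous_conj.comp (by fun_prop))
        (W.continuous_conj.comp (by fun_prop))) _))
  rmap := compRmap Z W
  smap := compSmap Z W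
  continuous_rmap := continuous_compRmap
  continuous_smap := continuous_compSmap
  rmap_conj c := by
    induction c using Quotient.inductionOn with
    | h p => exact Z.rmap_conj _
  smap_conj c := by
    induction c using Quotient.inductionOn with
    | h p => exact W.smap_conj _
  lact := compLact Z W
  ract := compRact Z W
  continuous_lact := continuous_compLact
  continuous_ract := continuous_compRact
  rmap_lact γ c e := by
    induction c using Quotient.inductionOn with
    | h p => exact Z.rmap_lact _ _ _
  smap_lact γ c e := by
    induction c using Quotient.inductionOn with
    | h p => rfl
  rmap_ract := compRmap_compRact
  smap_ract c h e := by
    induction c using Quotient.inductionOn with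
    | h p => exact W.smap_ract _ _ _
  unit_lact c := by
    induction c using Quotient.inductionOn with
    | h p => exact congrArg compMk (Subtype.ext (Prod.ext (Z.unit_lact _) rfl))
  ract_unit c := by
    induction c using Quotient.inductionOn with
    | h p => exact congrArg compMk (Subtype.ext (Prod.ext rfl (W.ract_unit _)))
  mul_lact γ δ c e₁ e₂ := by
    induction c using Quotient.inductionOn with
    | h p => exact congrArg compMk (Subtype.ext (Prod.ext (Z.mul_lact _ _ _ e₁ e₂) rfl))
  ract_mul c g h e₁ e₂ := by
    induction c using Quotient.inductionOn with
    | h p => exact congrArg compMk (Subtype.ext (Prod.ext rfl (W.ract_mul _ _ _ e₁ e₂)))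
  lact_ract γ c g e₁ e₂ := by
    induction c using Quotient.inductionOn with
    | h p => rfl
  conj_lact γ c e := by
    induction c using Quotient.inductionOn with
    | h p => exact congrArg compMk (Subtype.ext (Prod.ext (Z.conj_lact _ _ e) rfl))
  conj_ract c h e := by
    induction c using Quotient.inductionOn with
    | h p => exact congrArg compMk (Subtype.ext (Prod.ext rfl (W.conj_ract _ _ e)))
  locallySplit := comp_split
  principal := comp_principal

end GenMor

namespace RealGroupoid

variable (G : RealGroupoid.{u}) {A : Type u} [TopologicalSpace A]

lemma continuous_mul' {f h : A → G.Arr} (hf : Continuous f) (hh : Continuous h)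
    (e : ∀ a, G.src (f a) = G.rng (h a)) : Continuous fun a => G.mul (f a) (h a) (e a) :=
  G.continuous_mul.comp (g := fun p : {p : G.Arr × G.Arr // G.src p.1 = G.rng p.2} =>
    G.mul p.1.1 p.1.2 p.2) (Continuous.subtype_mk (hf.prodMk hh) e)

end RealGroupoid

namespace GenMor

variable {Γ G H K : RealGroupoid.{u}}

/-- `φ` is a `Γ`-`G`-equivariant Real map over `Γ.Ob` and `G.Ob`. -/
structure IsEquivariant (Z Z' : GenMor Γ G) (φ : Z.Z → Z'.Z) : Prop where
  rmap_eq : ∀ z, Z'.rmap (φ z) = Z.rmap z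
  smap_eq : ∀ z, Z'.smap (φ z) = Z.smap z
  conj_eq : ∀ z, φ (Z.conj z) = Z'.conj (φ z)
  lact_eq : ∀ γ z (e : Γ.src γ = Z.rmap z),
    φ (Z.lact γ z e) = Z'.lact γ (φ z) (e.trans (rmap_eq z).symm)
  ract_eq : ∀ z g (e : Z.smap z = G.rng g),
    φ (Z.ract z g e) = Z'.ract (φ z) g ((smap_eq z).trans e)

/-- Two Real generalized morphisms are isomorphic if there is an equivariant Real homeomorphism
between them. -/
def Isomorphic (Z Z' : GenMor Γ G) : Prop :=
  ∃ φ : Z.Z ≃ₜ Z'.Z, IsEquivariant Z Z' φ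

/-- An equivariant continuous map between principal bundles over the same base is a
homeomorphism. -/
lemma IsEquivariant.isomorphic {Z Z' : GenMor Γ G} {φ : Z.Z → Z'.Z} (h : IsEquivariant Z Z' φ)
    (hφ : Continuous φ) : Isomorphic Z Z' := by
  have hinj : Function.Injective φ := by
    intro z w hzw
    have hr : Z.rmap z = Z.rmap w := by rw [← h.rmap_eq, ← h.rmap_eq, hzw]
    have h1 := Z.ract_div ⟨(z, w), hr⟩
    have h2 := h.ract_eq z (Z.div ⟨(z, w), hr⟩) (Z.rng_div ⟨(z, w), hr⟩)
    have h3 : Z.div ⟨(z, w), hr⟩ = G.unit (Z.smap z) := by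
      refine Z'.ract_inj (φ z) _ _ ((h.smap_eq z).trans (Z.rng_div ⟨(z, w), hr⟩))
        (by simp [h.smap_eq]) ?_
      rw [← h2, h1, ract_unit', hzw]
    simp only [h3, ract_unit'] at h1
    exact h1
  have hsec : IsLocallySplit φ := by
    intro z'
    obtain ⟨U, hU, hy, σ, hσ, hs⟩ := Z.locallySplit (Z'.rmap z')
    have e1 : ∀ w : Z'.rmap ⁻¹' U, Z'.rmap (φ (σ ⟨_, w.2⟩)) = Z'.rmap w.1 := fun w => by
      rw [h.rmap_eq, hs]
    have e2 : ∀ w : Z'.rmap ⁻¹' U,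
        Z.smap (σ ⟨_, w.2⟩) = G.rng (Z'.div ⟨(φ (σ ⟨_, w.2⟩), w.1), e1 w⟩) := fun w => by
      rw [← h.smap_eq]; exact Z'.rng_div ⟨(φ (σ ⟨_, w.2⟩), w.1), e1 w⟩
    have c1 : Continuous fun w : Z'.rmap ⁻¹' U => σ ⟨_, w.2⟩ :=
      hσ.comp (Continuous.subtype_mk (Z'.continuous_rmap.comp continuous_subtype_val) _)
    refine ⟨_, hU.preimage Z'.continuous_rmap, hy,
      fun w => Z.ract (σ ⟨_, w.2⟩) (Z'.div ⟨(φ (σ ⟨_, w.2⟩), w.1), e1 w⟩) (e2 w), ?_, ?_⟩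
    · exact Z.continuous_ract' c1
        (Z'.continuous_div' (hφ.comp c1) continuous_subtype_val _) _
    · intro w
      rw [h.ract_eq]
      exact Z'.ract_div ⟨(φ (σ ⟨_, w.2⟩), w.1), e1 w⟩
  have hsurj : Function.Surjective φ := by
    intro z'
    obtain ⟨U, _, hz, σ, _, hs⟩ := hsec z'
    exact ⟨_, hs ⟨z', hz⟩⟩
  let e := Equiv.ofBijective φ ⟨hinj, hsurj⟩
  refine ⟨⟨e, hφ, hsec.continuous_of_comp ?_⟩, h⟩
  have : e.symm ∘ φ = id := by
    ext z; exact e.symm_apply_apply z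
  change Continuous (e.symm ∘ φ)
  rw [this]
  exact continuous_id

lemma Isomorphic.refl (Z : GenMor Γ G) : Isomorphic Z Z :=
  ⟨Homeomorph.refl _, ⟨fun _ => rfl, fun _ => rfl, fun _ => rfl, fun _ _ _ => rfl,
    fun _ _ _ => rfl⟩⟩

lemma Isomorphic.symm {Z Z' : GenMor Γ G} : Isomorphic Z Z' → Isomorphic Z' Z := by
  rintro ⟨φ, h⟩
  refine ⟨φ.symm, ⟨fun z => ?_, fun z => ?_, fun z => ?_, fun γ z e => ?_, fun z g e => ?_⟩⟩
  · rw [← h.rmap_eq, φ.apply_symm_apply]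
  · rw [← h.smap_eq, φ.apply_symm_apply]
  · rw [φ.symm_apply_eq, h.conj_eq, φ.apply_symm_apply]
  · rw [φ.symm_apply_eq, h.lact_eq]
    simp only [φ.apply_symm_apply]
  · rw [φ.symm_apply_eq, h.ract_eq]
    simp only [φ.apply_symm_apply]

lemma Isomorphic.trans {Z Z' Z'' : GenMor Γ G} :
    Isomorphic Z Z' → Isomorphic Z' Z'' → Isomorphic Z Z'' := by
  rintro ⟨φ, h⟩ ⟨ψ, k⟩
  refine ⟨φ.trans ψ, ⟨fun z => ?_, fun z => ?_, fun z => ?_, fun γ z e => ?_, fun z g e => ?_⟩⟩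
  · exact (k.rmap_eq _).trans (h.rmap_eq _)
  · exact (k.smap_eq _).trans (h.smap_eq _)
  · exact (congrArg ψ (h.conj_eq _)).trans (k.conj_eq _)
  · exact (congrArg ψ (h.lact_eq _ _ e)).trans (k.lact_eq _ _ _)
  · exact (congrArg ψ (h.ract_eq _ _ e)).trans (k.ract_eq _ _ _)

/-- The setoid of isomorphism of Real generalized morphisms. -/
instance isoSetoid (Γ G : RealGroupoid.{u}) : Setoid (GenMor Γ G) where
  r := Isomorphic
  iseqv := ⟨Isomorphic.refl, Isomorphic.symm, Isomorphic.trans⟩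

/-- Descend an equivariant map to the composite. -/
lemma isomorphic_of_lift {Z : GenMor Γ G} {W : GenMor G H} {V : GenMor Γ H}
    (F : CompPt Z W → V.Z) (hF : Continuous F)
    (h0 : ∀ p q, (compSetoid Z W).r p q → F p = F q)
    (hr : ∀ p, V.rmap (F p) = Z.rmap p.1.1) (hs : ∀ p, V.smap (F p) = W.smap p.1.2)
    (hc : ∀ p, F ⟨(Z.conj p.1.1, W.conj p.1.2), by simp [p.2]⟩ = V.conj (F p))
    (hl : ∀ γ p (e : Γ.src γ = Z.rmap p.1.1),
      F ⟨(Z.lact γ p.1.1 e, p.1.2), (Z.smap_lact _ _ _).trans p.2⟩ =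
        V.lact γ (F p) (e.trans (hr p).symm))
    (ha : ∀ p h (e : W.smap p.1.2 = H.rng h),
      F ⟨(p.1.1, W.ract p.1.2 h e), p.2.trans (W.rmap_ract _ _ _).symm⟩ =
        V.ract (F p) h ((hs p).trans e)) :
    Isomorphic (comp Z W) V := by
  refine IsEquivariant.isomorphic (φ := fun c : CompQuot Z W => Quotient.lift F h0 c)
    ⟨fun c => ?_, fun c => ?_, fun c => ?_, fun γ c e => ?_, fun c g e => ?_⟩
    (continuous_quot_lift _ hF) <;>
  induction c using Quotient.inductionOn with
  | h p => ?_
  · exact hr p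
  · exact hs p
  · exact hc p
  · exact hl γ p e
  · exact ha p g e

lemma comp_congr {Z Z' : GenMor Γ G} {W W' : GenMor G H} (h : Isomorphic Z Z')
    (k : Isomorphic W W') : Isomorphic (comp Z W) (comp Z' W') := by
  obtain ⟨φ, h⟩ := h
  obtain ⟨ψ, k⟩ := k
  refine isomorphic_of_lift (V := comp Z' W')
    (fun p => compMk ⟨(φ p.1.1, ψ p.1.2), by rw [h.smap_eq, k.rmap_eq, p.2]⟩) ?_ ?_ ?_ ?_ ?_ ?_ ?_
  · exact continuous_compMk.comp (Continuous.subtype_mk (by fun_prop) _)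
  · rintro p q ⟨g, e, h1, h2⟩
    refine Quotient.sound ⟨g, by rw [← e]; exact h.smap_eq _, ?_, ?_⟩
    · exact (congrArg φ h1).trans (h.ract_eq _ _ _)
    · exact (congrArg ψ h2).trans (k.lact_eq _ _ _)
  · exact fun p => h.rmap_eq _
  · exact fun p => k.smap_eq _
  · exact fun p => congrArg compMk (Subtype.ext (Prod.ext (h.conj_eq _) (k.conj_eq _)))
  · exact fun γ p e => congrArg compMk (Subtype.ext (Prod.ext (h.lact_eq _ _ _) rfl))
  · exact fun p g e => congrArg compMk (Subtype.ext (Prod.ext rfl (k.ract_eq _ _ _)))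

lemma ofStrict_principal (f : StrictMor Γ G) : IsHomeomorph fun p :
    {p : {p : Γ.Ob × G.Arr // f.onOb p.1 = G.rng p.2} × G.Arr // G.src p.1.1.2 = G.rng p.2} =>
    (⟨(p.1.1, ⟨(p.1.1.1.1, G.mul p.1.1.1.2 p.1.2 p.2), by
      rw [G.rng_mul]; exact p.1.1.2⟩), rfl⟩ :
      {q : {p : Γ.Ob × G.Arr // f.onOb p.1 = G.rng p.2} ×
        {p : Γ.Ob × G.Arr // f.onOb p.1 = G.rng p.2} // q.1.1.1 = q.2.1.1}) := by
  refine isHomeomorph_of_div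
    (A := {p : Γ.Ob × G.Arr // f.onOb p.1 = G.rng p.2}) (B := G.Arr)
    (P := fun p g => G.src p.1.2 = G.rng g)
    (act := fun p g e => ⟨(p.1.1, G.mul p.1.2 g e), by
      rw [G.rng_mul]; exact p.2⟩)
    (q := fun p => p.1.1) (fun a b h => rfl)
    (Continuous.subtype_mk (Continuous.prodMk (by fun_prop)
      (G.continuous_mul' (by fun_prop) (by fun_prop) _)) _)
    (fun p => G.mul (G.inv p.1.1.1.2) p.1.2.1.2 (by
      rw [G.src_inv, ← p.1.1.2, ← p.1.2.2]; exact congrArg f.onOb p.2)) ?_ ?_ ?_ ?_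
  · exact G.continuous_mul' (G.continuous_inv.comp (by fun_prop)) (by fun_prop) _
  · intro p; simp
  · intro p
    apply Subtype.ext
    apply Prod.ext
    · exact p.2
    · exact G.mul_inv_cancel_left _ _ (by
        rw [← p.1.1.2, ← p.1.2.2]; exact congrArg f.onOb p.2)
  · intro a b h
    exact G.inv_mul_cancel_left _ _ _

/-- The generalized morphism `Z_f = Γ.Ob ×_{f, G.Ob, rng} G.Arr` of a strict morphism `f`, with
`γ (y, g) = (rng γ, f γ · g)` and `(y, g) g' = (y, g g')`. -/
def ofStrict (f : StrictMor Γ G) : GenMor Γ G where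
  Z := {p : Γ.Ob × G.Arr // f.onOb p.1 = G.rng p.2}
  lc := (isClosed_eq (f.continuous_onOb.comp continuous_fst)
    (G.continuous_rng.comp continuous_snd)).isClosedEmbedding_subtypeVal.locallyCompactSpace
  conj p := ⟨(Γ.conjOb p.1.1, G.conjArr p.1.2), by simp [p.2]⟩
  conj_conj p := by simp
  continuous_conj := by
    refine Continuous.subtype_mk (Continuous.prodMk
    (Γ.continuous_conjOb.comp (by fun_prop)) (G.continuous_conjArr.comp (by fun_prop))) _
  rmap p := p.1.1
  smap p := G.src p.1.2
  continuous_rmap := by fun_prop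
  continuous_smap := G.continuous_src.comp (by fun_prop)
  rmap_conj p := rfl
  smap_conj p := by simp
  lact γ p e := ⟨(Γ.rng γ, G.mul (f.onArr γ) p.1.2 (by rw [f.src_onArr, e, p.2])), by simp⟩
  ract p g e := ⟨(p.1.1, G.mul p.1.2 g e), by simp [p.2]⟩
  continuous_lact := by
    refine Continuous.subtype_mk (Continuous.prodMk
    (Γ.continuous_rng.comp (by fun_prop))
    (G.continuous_mul' (f.continuous_onArr.comp (by fun_prop)) (by fun_prop) _)) _
  continuous_ract := by
    refine Continuous.subtype_mk (Continuous.prodMk (by fun_prop)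
    (G.continuous_mul' (by fun_prop) (by fun_prop) _)) _
  rmap_lact γ p e := rfl
  smap_lact γ p e := by simp
  rmap_ract p g e := rfl
  smap_ract p g e := by simp
  unit_lact p := by
    apply Subtype.ext
    apply Prod.ext
    · simp
    · simp [G.unit_mul']
  ract_unit p := by simp
  mul_lact γ δ p e₁ e₂ := by
    apply Subtype.ext
    apply Prod.ext
    · simp
    · simp only [f.map_mul]
      rw [G.mul_assoc]
  ract_mul p g h e₁ e₂ := by
    apply Subtype.ext
    apply Prod.ext
    · rfl
    · exact (G.mul_assoc _ _ _ e₁ e₂).symm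
  lact_ract γ p g e₁ e₂ := by
    apply Subtype.ext
    apply Prod.ext
    · rfl
    · exact (G.mul_assoc _ _ _ _ e₂).symm
  conj_lact γ p e := by
    apply Subtype.ext
    apply Prod.ext <;> simp
  conj_ract p g e := by
    apply Subtype.ext
    apply Prod.ext <;> simp
  locallySplit y := by
    refine ⟨Set.univ, isOpen_univ, trivial,
      fun x => ⟨(x.1, G.unit (f.onOb x.1)), by simp⟩, ?_, fun _ => rfl⟩
    exact Continuous.subtype_mk (Continuous.prodMk (by fun_prop)
      (G.continuous_unit.comp (f.continuous_onOb.comp continuous_subtype_val))) _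
  principal := ofStrict_principal f

/-- The second coordinate of a point of `Z_f`. -/
def arr (f : StrictMor Γ G) (p : (ofStrict f).Z) : G.Arr := p.1.2

lemma continuous_arr (f : StrictMor Γ G) : Continuous (arr f) :=
  continuous_snd.comp continuous_subtype_val

lemma rng_arr (f : StrictMor Γ G) (p : (ofStrict f).Z) :
    G.rng (arr f p) = f.onOb ((ofStrict f).rmap p) := p.2.symm

lemma src_arr (f : StrictMor Γ G) (p : (ofStrict f).Z) :
    G.src (arr f p) = (ofStrict f).smap p := rfl

lemma arr_ract (f : StrictMor Γ G) (p : (ofStrict f).Z) (g : G.Arr)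
    (e : (ofStrict f).smap p = G.rng g) : arr f ((ofStrict f).ract p g e) =
      G.mul (arr f p) g e := rfl

lemma arr_lact (f : StrictMor Γ G) (γ : Γ.Arr) (p : (ofStrict f).Z)
    (e : Γ.src γ = (ofStrict f).rmap p) : arr f ((ofStrict f).lact γ p e) =
      G.mul (f.onArr γ) (arr f p) (by rw [f.src_onArr, rng_arr, e]) := rfl

lemma arr_conj (f : StrictMor Γ G) (p : (ofStrict f).Z) :
    arr f ((ofStrict f).conj p) = G.conjArr (arr f p) := rfl

/-- The identity generalized morphism `Z_id` of `Γ`. -/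
abbrev idMor (Γ : RealGroupoid.{u}) : GenMor Γ Γ := ofStrict (StrictMor.idStrict Γ)

lemma comp_id (Z : GenMor Γ G) : Isomorphic (comp Z (idMor G)) Z := by
  have e0 : ∀ p : CompPt Z (idMor G), Z.smap p.1.1 = G.rng (arr (StrictMor.idStrict G) p.1.2) :=
    fun p => p.2.trans (rng_arr (StrictMor.idStrict G) p.1.2).symm
  refine isomorphic_of_lift (Z := Z) (W := idMor G) (V := Z)
    (fun p => Z.ract p.1.1 (arr (StrictMor.idStrict G) p.1.2) (e0 p)) ?_ ?_ ?_ ?_ ?_ ?_ ?_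
  · exact Z.continuous_ract' (by fun_prop) ((continuous_arr (StrictMor.idStrict G)).comp
      (continuous_snd.comp continuous_subtype_val)) _
  · rintro ⟨⟨z, k⟩, hp⟩ ⟨⟨z', k'⟩, hp'⟩ ⟨g, e, h1, h2⟩
    simp only at h1 h2 e
    subst h1 h2
    have ek : G.rng g = G.rng (arr (StrictMor.idStrict G) k) := e.symm.trans (e0 ⟨(z, k), hp⟩)
    refine Eq.trans ?_ (Z.ract_mul z g _ e (by rw [← e0 ⟨_, hp'⟩]; simp))
    have h4 := G.mul_inv_cancel_left g _ ek
    congr 1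
    exact h4.symm
  · intro p; simp
  · intro p; exact Z.smap_ract _ _ _
  · intro p; exact (Z.conj_ract _ _ _).symm
  · intro γ p e; exact (Z.lact_ract _ _ _ _ _).symm
  · intro p h e; exact Z.ract_mul _ _ _ _ e

lemma id_comp (Z : GenMor Γ G) : Isomorphic (comp (idMor Γ) Z) Z := by
  have e0 : ∀ p : CompPt (idMor Γ) Z, Γ.src (arr (StrictMor.idStrict Γ) p.1.1) = Z.rmap p.1.2 :=
    fun p => (src_arr (StrictMor.idStrict Γ) p.1.1).trans p.2
  refine isomorphic_of_lift (Z := idMor Γ) (W := Z) (V := Z)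
    (fun p => Z.lact (arr (StrictMor.idStrict Γ) p.1.1) p.1.2 (e0 p)) ?_ ?_ ?_ ?_ ?_ ?_ ?_
  · exact Z.continuous_lact' ((continuous_arr (StrictMor.idStrict Γ)).comp
      (continuous_fst.comp continuous_subtype_val)) (by fun_prop) _
  · rintro ⟨⟨k, z⟩, hp⟩ ⟨⟨k', z'⟩, hp'⟩ ⟨g, e, h1, h2⟩
    simp only at h1 h2 e
    subst h1 h2
    change Γ.src (arr (StrictMor.idStrict Γ) k) = Γ.rng g at e
    have h4 := Z.mul_lact _ g (Z.lact (Γ.inv g) z (by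
      rw [Γ.src_inv, ← e]; exact hp)) e (by simp)
    simp only [lact_inv_lact] at h4
    rw [← h4]
    rfl
  · intro p; exact (Z.rmap_lact _ _ _).trans (rng_arr (StrictMor.idStrict Γ) p.1.1)
  · intro p; simp
  · intro p; exact (Z.conj_lact _ _ _).symm
  · intro γ p e; exact Z.mul_lact _ _ _ _ (e0 p)
  · intro p h e; exact Z.lact_ract _ _ _ _ e

lemma comp_assoc (Z : GenMor Γ G) (W : GenMor G H) (V : GenMor H K) :
    Isomorphic (comp (comp Z W) V) (comp Z (comp W V)) := by
  refine Isomorphic.symm ?_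
  have key : ∀ (z : Z.Z) (c : (comp W V).Z), Z.smap z = (comp W V).rmap c →
      ∃ d : (comp (comp Z W) V).Z, ∀ (p : CompPt W V) (hz : Z.smap z = W.rmap p.1.1),
        c = compMk p → d = compMk ⟨(compMk ⟨(z, p.1.1), hz⟩, p.1.2), p.2⟩ := by
    intro z c hc
    induction c using Quotient.inductionOn with
    | h p =>
      refine ⟨compMk ⟨(compMk ⟨(z, p.1.1), hc⟩, p.1.2), p.2⟩, fun q hz hq => ?_⟩
      obtain ⟨g, e, h1, h2⟩ := Quotient.exact hq
      refine Quotient.sound ⟨g, e, ?_, h2⟩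
      exact congrArg compMk (Subtype.ext (Prod.ext rfl h1))
  let F : CompPt Z (comp W V) → (comp (comp Z W) V).Z := fun p => (key p.1.1 p.1.2 p.2).choose
  have hF : ∀ (z : Z.Z) (p : CompPt W V) (hz : Z.smap z = W.rmap p.1.1),
      F ⟨(z, compMk p), hz⟩ = compMk ⟨(compMk ⟨(z, p.1.1), hz⟩, p.1.2), p.2⟩ :=
    fun z p hz => (key z (compMk p) hz).choose_spec p hz rfl
  have ind : ∀ {P : CompPt Z (comp W V) → Prop},
      (∀ (z : Z.Z) (p : CompPt W V) (hz : Z.smap z = W.rmap p.1.1), P ⟨(z, compMk p), hz⟩) →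
      ∀ x, P x := by
    rintro P h ⟨⟨z, c⟩, hc⟩
    induction c using Quotient.inductionOn with
    | h p => exact h z p hc
  refine isomorphic_of_lift (V := comp (comp Z W) V) F ?_ ?_ ?_ ?_ ?_ ?_ ?_
  · refine (compMk_split (Z := W) (W := V)).continuous_of_pullback
      (a := fun p : CompPt Z (comp W V) => p.1.2) (by fun_prop) ?_
    have this : ∀ x : {x : CompPt Z (comp W V) × CompPt W V // x.1.1.2 = compMk x.2},
        Z.smap x.1.1.1.1 = W.rmap x.1.2.1.1 := by
      rintro ⟨⟨⟨⟨z, c⟩, hc⟩, p⟩, E⟩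
      change c = compMk p at E
      subst E; exact hc
    have hc : Continuous fun x : {x : CompPt Z (comp W V) × CompPt W V // x.1.1.2 = compMk x.2} =>
        (compMk (Z := comp Z W) (W := V)
          ⟨(compMk ⟨(x.1.1.1.1, x.1.2.1.1), this x⟩, x.1.2.1.2), x.1.2.2⟩) := by
      refine continuous_compMk.comp (Continuous.subtype_mk (Continuous.prodMk
        (continuous_compMk.comp (Continuous.subtype_mk ?_ _)) (by fun_prop)) _)
      fun_prop
    refine hc.congr fun x => ?_
    symm
    obtain ⟨⟨⟨⟨z, c⟩, hc⟩, p⟩, E⟩ := x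
    change c = compMk p at E
    subst E; exact hF z p hc
  · refine fun p => ind (P := fun p => ∀ q, (compSetoid Z (comp W V)).r p q → F p = F q) ?_ p
    rintro z ⟨⟨w, v⟩, hp⟩ hz ⟨⟨z', c⟩, hq⟩ ⟨g, e, h1, h2⟩
    simp only at h1 h2
    subst h1
    change c = compMk ⟨(W.lact (G.inv g) w _, v), _⟩ at h2
    subst h2
    rw [hF, hF _ _ hq]
    refine congrArg compMk (Subtype.ext (Prod.ext ?_ rfl))
    exact Quotient.sound ⟨g, e, rfl, rfl⟩
  · exact ind fun z p hz => by rw [hF]; rfl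
  · exact ind fun z p hz => by rw [hF]; rfl
  · refine ind fun z p hz => ?_
    rw [hF]
    exact hF (Z.conj z) ⟨(W.conj p.1.1, V.conj p.1.2), by simp [p.2]⟩ (by simp [hz])
  · refine fun γ => ind fun z p hz e => ?_
    simp only [hF]
    exact hF (Z.lact γ z e) p ((Z.smap_lact _ _ _).trans hz)
  · refine ind fun z p hz h e => ?_
    have h1 := hF z ⟨(p.1.1, V.ract p.1.2 h e), p.2.trans (V.rmap_ract _ _ _).symm⟩ hz
    simp only [hF]
    exact h1

end GenMor

/-- The category `RG`: objects are Real groupoids, morphisms are isomorphism classes of Real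
generalized morphisms. -/
def RG : Type (u + 1) := RealGroupoid.{u}

instance : Category.{u + 1} RG.{u} where
  Hom Γ G := Quotient (GenMor.isoSetoid Γ G)
  id Γ := Quotient.mk _ (GenMor.idMor Γ)
  comp := Quotient.map₂ GenMor.comp fun _ _ h _ _ k => GenMor.comp_congr h k
  id_comp := by rintro _ _ ⟨Z⟩; exact Quotient.sound (GenMor.id_comp Z)
  comp_id := by rintro _ _ ⟨Z⟩; exact Quotient.sound (GenMor.comp_id Z)
  assoc := by rintro _ _ _ _ ⟨Z⟩ ⟨W⟩ ⟨V⟩; exact Quotient.sound (GenMor.comp_assoc Z W V)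

namespace GenMor

variable {Γ G : RealGroupoid.{u}}

/-- `Z` is a Morita equivalence: `smap : Z → G.Ob` is a principal `Γ`-bundle as well. -/
structure IsMorita (Z : GenMor Γ G) : Prop where
  locallySplit : IsLocallySplit Z.smap
  principal : IsHomeomorph fun p : {p : Γ.Arr × Z.Z // Γ.src p.1 = Z.rmap p.2} =>
    (⟨(p.1.2, Z.lact p.1.1 p.1.2 p.2), (Z.smap_lact _ _ _).symm⟩ :
      {q : Z.Z × Z.Z // Z.smap q.1 = Z.smap q.2})

/-- The inverse `Z⁻¹` of a Morita equivalence `Z`: the same Real space with the actions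
`g z := z g⁻¹` and `z γ := γ⁻¹ z`. -/
def inv (Z : GenMor Γ G) (hZ : IsMorita Z) : GenMor G Γ where
  Z := Z.Z
  conj := Z.conj
  conj_conj := Z.conj_conj
  continuous_conj := Z.continuous_conj
  rmap := Z.smap
  smap := Z.rmap
  continuous_rmap := Z.continuous_smap
  continuous_smap := Z.continuous_rmap
  rmap_conj := Z.smap_conj
  smap_conj := Z.rmap_conj
  lact g z e := Z.ract z (G.inv g) (e.symm.trans (G.rng_inv g).symm)
  ract z γ e := Z.lact (Γ.inv γ) z ((Γ.src_inv γ).trans e.symm)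
  continuous_lact := by
    exact Z.continuous_ract' (by fun_prop) (G.continuous_inv.comp (by fun_prop)) _
  continuous_ract := by
    exact Z.continuous_lact' (Γ.continuous_inv.comp (by fun_prop)) (by fun_prop) _
  rmap_lact g z e := by simp
  smap_lact g z e := by simp
  rmap_ract z γ e := by simp
  smap_ract z γ e := by simp
  unit_lact z := by simp [Z.ract_unit']
  ract_unit z := by simp [Z.unit_lact']
  mul_lact g h z e₁ e₂ := by
    simp only [G.inv_mul_rev _ _ e₁]
    rw [Z.ract_mul]
  ract_mul z γ δ e₁ e₂ := by
    simp only [Γ.inv_mul_rev _ _ e₂]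
    rw [Z.mul_lact]
  lact_ract g z γ e₁ e₂ := (Z.lact_ract _ _ _ _ _).symm
  conj_lact g z e := by simp
  conj_ract z γ e := by simp
  locallySplit := hZ.locallySplit
  principal := by
    let e : {p : Z.Z × Γ.Arr // Z.rmap p.1 = Γ.rng p.2} ≃ₜ
        {p : Γ.Arr × Z.Z // Γ.src p.1 = Z.rmap p.2} :=
      { toFun := fun p => ⟨(Γ.inv p.1.2, p.1.1), by simp [p.2]⟩
        invFun := fun p => ⟨(p.1.2, Γ.inv p.1.1), by simp [p.2]⟩
        left_inv := fun p => by simp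
        right_inv := fun p => by simp
        continuous_toFun := by
          exact Continuous.subtype_mk
            ((Γ.continuous_inv.comp (by fun_prop)).prodMk (by fun_prop)) _
        continuous_invFun := by
          exact Continuous.subtype_mk
            (Continuous.prodMk (by fun_prop) (Γ.continuous_inv.comp (by fun_prop))) _ }
    exact hZ.principal.comp e.isHomeomorph

end GenMor

/-- A Real open cover of the unit space of `Γ`: a family of open sets `U j` with union `Γ.Ob`,
indexed by a (discrete) set `J` with an involution `j ↦ bar j` such that `U (bar j)` is the
conjugate of `U j`. -/
structure RealCover (Γ : RealGroupoid.{u}) : Type (u + 1) where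
  J : Type u
  [topJ : TopologicalSpace J]
  [discrete : DiscreteTopology J]
  bar : J → J
  bar_bar : ∀ j, bar (bar j) = j
  U : J → Set Γ.Ob
  isOpen : ∀ j, IsOpen (U j)
  exists_mem : ∀ y, ∃ j, y ∈ U j
  U_bar : ∀ j, U (bar j) = Γ.conjOb '' U j

attribute [instance] RealCover.topJ RealCover.discrete

namespace RealCover

variable {Γ : RealGroupoid.{u}} (𝒰 : RealCover Γ)

lemma conj_mem {j : 𝒰.J} {y : Γ.Ob} (h : y ∈ 𝒰.U j) : Γ.conjOb y ∈ 𝒰.U (𝒰.bar j) := by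
  rw [𝒰.U_bar]; exact ⟨y, h, rfl⟩

lemma isOpen_total : IsOpen {p : 𝒰.J × Γ.Ob | p.2 ∈ 𝒰.U p.1} := by
  have : {p : 𝒰.J × Γ.Ob | p.2 ∈ 𝒰.U p.1} = ⋃ j, {j} ×ˢ 𝒰.U j := by
    ext ⟨j, y⟩; simp
  rw [this]
  exact isOpen_iUnion fun j => (isOpen_discrete _).prod (𝒰.isOpen j)

/-- The cover groupoid `Γ[𝒰]`, with unit space `∐ⱼ Uⱼ = {(j, y) | y ∈ U j}` and arrows
`(j₀, γ, j₁)` with `rng γ ∈ U j₀` and `src γ ∈ U j₁`. -/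
def groupoid : RealGroupoid.{u} where
  Ob := {p : 𝒰.J × Γ.Ob // p.2 ∈ 𝒰.U p.1}
  Arr := {p : 𝒰.J × Γ.Arr × 𝒰.J // Γ.rng p.2.1 ∈ 𝒰.U p.1 ∧ Γ.src p.2.1 ∈ 𝒰.U p.2.2}
  lcOb := 𝒰.isOpen_total.locallyCompactSpace
  lcArr := by
    refine IsOpen.locallyCompactSpace (s := {p : 𝒰.J × Γ.Arr × 𝒰.J |
      Γ.rng p.2.1 ∈ 𝒰.U p.1 ∧ Γ.src p.2.1 ∈ 𝒰.U p.2.2}) ?_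
    exact (𝒰.isOpen_total.preimage (f := fun p : 𝒰.J × Γ.Arr × 𝒰.J => (p.1, Γ.rng p.2.1))
        (Continuous.prodMk (by fun_prop) (Γ.continuous_rng.comp (by fun_prop)))).inter
      (𝒰.isOpen_total.preimage (f := fun p : 𝒰.J × Γ.Arr × 𝒰.J => (p.2.2, Γ.src p.2.1))
        (Continuous.prodMk (by fun_prop) (Γ.continuous_src.comp (by fun_prop))))
  src p := ⟨(p.1.2.2, Γ.src p.1.2.1), p.2.2⟩
  rng p := ⟨(p.1.1, Γ.rng p.1.2.1), p.2.1⟩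
  unit x := ⟨(x.1.1, Γ.unit x.1.2, x.1.1), by simp [x.2]⟩
  inv p := ⟨(p.1.2.2, Γ.inv p.1.2.1, p.1.1), by simp [p.2]⟩
  mul p q e := ⟨(p.1.1, Γ.mul p.1.2.1 q.1.2.1 (congrArg (fun x => x.1.2) e), q.1.2.2), by
    simp [p.2.1, q.2.2]⟩
  src_unit x := by simp
  rng_unit x := by simp
  src_mul p q e := by simp
  rng_mul p q e := by simp
  src_inv p := by simp
  rng_inv p := by simp
  mul_assoc p q r e₁ e₂ := by
    simp only [Subtype.mk.injEq, Prod.mk.injEq, true_and, and_true]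
    exact Γ.mul_assoc _ _ _ _ _
  unit_mul p := by simp
  mul_unit p := by simp
  inv_mul p := by simp
  mul_inv p := by simp
  continuous_src := by
    refine Continuous.subtype_mk (Continuous.prodMk (by fun_prop)
      (Γ.continuous_src.comp (by fun_prop))) _
  continuous_rng := by
    refine Continuous.subtype_mk (Continuous.prodMk (by fun_prop)
      (Γ.continuous_rng.comp (by fun_prop))) _
  continuous_unit := by
    refine Continuous.subtype_mk (Continuous.prodMk (by fun_prop)
      (Continuous.prodMk (Γ.continuous_unit.comp (by fun_prop)) (by fun_prop))) _
  continuous_inv := by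
    refine Continuous.subtype_mk (Continuous.prodMk (by fun_prop)
      (Continuous.prodMk (Γ.continuous_inv.comp (by fun_prop)) (by fun_prop))) _
  continuous_mul := by
    refine Continuous.subtype_mk (Continuous.prodMk (by fun_prop)
      (Continuous.prodMk (Γ.continuous_mul' (by fun_prop) (by fun_prop) _) (by fun_prop))) _
  conjOb x := ⟨(𝒰.bar x.1.1, Γ.conjOb x.1.2), 𝒰.conj_mem x.2⟩
  conjArr p := ⟨(𝒰.bar p.1.1, Γ.conjArr p.1.2.1, 𝒰.bar p.1.2.2), by
    rw [Γ.rng_conj, Γ.src_conj]; exact ⟨𝒰.conj_mem p.2.1, 𝒰.conj_mem p.2.2⟩⟩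
  conjOb_conjOb x := by simp [𝒰.bar_bar]
  conjArr_conjArr p := by simp [𝒰.bar_bar]
  continuous_conjOb := by
    refine Continuous.subtype_mk (Continuous.prodMk
      (continuous_of_discreteTopology.comp (by fun_prop))
      (Γ.continuous_conjOb.comp (by fun_prop))) _
  continuous_conjArr := by
    refine Continuous.subtype_mk (Continuous.prodMk
      (continuous_of_discreteTopology.comp (by fun_prop)) (Continuous.prodMk
      (Γ.continuous_conjArr.comp (by fun_prop))
      (continuous_of_discreteTopology.comp (by fun_prop)))) _
  src_conj p := by simp
  rng_conj p := by simp
  conj_unit x := by simp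
  conj_mul p q e := by simp

/-- The canonical strict morphism `ι : Γ[𝒰] → Γ`, `(j₀, γ, j₁) ↦ γ`. -/
def iota : StrictMor 𝒰.groupoid Γ where
  onOb x := x.1.2
  onArr p := p.1.2.1
  continuous_onOb := continuous_snd.comp continuous_subtype_val
  continuous_onArr := continuous_fst.comp (continuous_snd.comp continuous_subtype_val)
  src_onArr _ := rfl
  rng_onArr _ := rfl
  map_unit _ := rfl
  map_mul _ _ _ := rfl
  conj_onOb _ := rfl
  conj_onArr _ := rfl

/-- `Z_ι` is a Morita equivalence between `Γ[𝒰]` and `Γ`. -/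
lemma isMorita_iota : GenMor.IsMorita (GenMor.ofStrict 𝒰.iota) where
  locallySplit y := by
    obtain ⟨j, hj⟩ := 𝒰.exists_mem y
    refine ⟨𝒰.U j, 𝒰.isOpen j, hj,
      fun x => ⟨(⟨(j, x.1), x.2⟩, Γ.unit x.1), (Γ.rng_unit _).symm⟩, ?_, fun x => Γ.src_unit _⟩
    refine Continuous.subtype_mk (Continuous.prodMk (Continuous.subtype_mk ?_ _)
      (Γ.continuous_unit.comp continuous_subtype_val)) _
    fun_prop
  principal := by
    have e0 : ∀ q : {q : (GenMor.ofStrict 𝒰.iota).Z × (GenMor.ofStrict 𝒰.iota).Z //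
        (GenMor.ofStrict 𝒰.iota).smap q.1 = (GenMor.ofStrict 𝒰.iota).smap q.2},
        Γ.src q.1.2.1.2 = Γ.rng (Γ.inv q.1.1.1.2) := fun q =>
      q.2.symm.trans (Γ.rng_inv _).symm
    let e : {p : 𝒰.groupoid.Arr × (GenMor.ofStrict 𝒰.iota).Z //
        𝒰.groupoid.src p.1 = (GenMor.ofStrict 𝒰.iota).rmap p.2} ≃ₜ
        {q : (GenMor.ofStrict 𝒰.iota).Z × (GenMor.ofStrict 𝒰.iota).Z //
          (GenMor.ofStrict 𝒰.iota).smap q.1 = (GenMor.ofStrict 𝒰.iota).smap q.2} :=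
      { toFun := fun p => ⟨(p.1.2, (GenMor.ofStrict 𝒰.iota).lact p.1.1 p.1.2 p.2),
          ((GenMor.ofStrict 𝒰.iota).smap_lact p.1.1 p.1.2 p.2).symm⟩
        invFun := fun q => ⟨(⟨(q.1.2.1.1.1.1, Γ.mul q.1.2.1.2 (Γ.inv q.1.1.1.2) (e0 q),
          q.1.1.1.1.1.1), by
            refine ⟨?_, ?_⟩
            · rw [Γ.rng_mul, ← q.1.2.2]; exact q.1.2.1.1.2
            · rw [Γ.src_mul, Γ.src_inv, ← q.1.1.2]; exact q.1.1.1.1.2⟩, q.1.1), by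
          apply Subtype.ext
          apply Prod.ext
          · rfl
          · change Γ.src (Γ.mul _ _ _) = q.1.1.1.1.1.2
            rw [Γ.src_mul, Γ.src_inv]; exact q.1.1.2.symm⟩
        left_inv := ?_
        right_inv := ?_
        continuous_toFun := ?_
        continuous_invFun := ?_ }
    · exact e.isHomeomorph
    · rintro ⟨⟨⟨⟨j, γ, j'⟩, h⟩, ⟨⟨⟨⟨k, y⟩, hy⟩, δ⟩, hδ⟩⟩, E⟩
      have E1 : j' = k := congrArg (fun x => x.1.1) E
      have E2 : Γ.src γ = y := congrArg (fun x => x.1.2) E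
      have hδ' : y = Γ.rng δ := hδ
      apply Subtype.ext
      refine Prod.ext (Subtype.ext (Prod.ext rfl (Prod.ext ?_ E1.symm))) rfl
      change Γ.mul (Γ.mul γ δ _) (Γ.inv δ) _ = γ
      rw [Γ.mul_assoc _ _ _ (E2.trans hδ') (by simp)]
      simp [Γ.mul_unit']
    · rintro ⟨⟨⟨⟨⟨⟨k, y⟩, hy⟩, δ⟩, hδ⟩, ⟨⟨⟨⟨k', y'⟩, hy'⟩, δ'⟩, hδ'⟩⟩, E⟩
      have E' : Γ.src δ = Γ.src δ' := E
      have h1 : y' = Γ.rng δ' := hδ'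
      apply Subtype.ext
      refine Prod.ext rfl (Subtype.ext (Prod.ext (Subtype.ext (Prod.ext rfl ?_)) ?_))
      · change Γ.rng (Γ.mul _ _ _) = y'
        rw [Γ.rng_mul]; exact h1.symm
      · change Γ.mul (Γ.mul δ' (Γ.inv δ) _) δ _ = δ'
        rw [Γ.mul_assoc _ _ _ (by simp [E']) (by simp)]
        simp [Γ.mul_unit']
    · exact Continuous.subtype_mk (Continuous.prodMk (by fun_prop)
        (GenMor.continuous_lact _)) _
    · have c : Continuous fun z : (GenMor.ofStrict 𝒰.iota).Z => z.1.1.1.1 :=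
        continuous_fst.comp (continuous_subtype_val.comp
          (continuous_fst.comp continuous_subtype_val))
      have c' := GenMor.continuous_arr 𝒰.iota
      refine Continuous.subtype_mk (Continuous.prodMk (Continuous.subtype_mk
        (Continuous.prodMk (c.comp (by fun_prop)) (Continuous.prodMk
          (Γ.continuous_mul' (c'.comp (by fun_prop))
            (Γ.continuous_inv.comp (c'.comp (by fun_prop))) _) (c.comp (by fun_prop)))) _)
        (by fun_prop)) _

/-- The trivial Real open cover `{Γ.Ob}`. -/
def trivialCover (Γ : RealGroupoid.{u}) : RealCover Γ where
  J := PUnit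
  bar j := j
  bar_bar _ := rfl
  U _ := Set.univ
  isOpen _ := isOpen_univ
  exists_mem y := ⟨PUnit.unit, Set.mem_univ y⟩
  U_bar _ := by
    rw [Set.image_univ]
    exact (Set.range_eq_univ.2 fun y => ⟨Γ.conjOb y, Γ.conjOb_conjOb y⟩).symm

/-- The Real open cover of `Γ.Ob` refining `𝒰` that is given by a Real open cover `𝒲` of the
unit space `∐ⱼ Uⱼ` of `Γ[𝒰]`: the sets `{y ∈ U j | (j, y) ∈ W w}`, indexed by the pairs
`(w, j)`. -/
def refinement (𝒲 : RealCover 𝒰.groupoid) : RealCover Γ where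
  J := 𝒲.J × 𝒰.J
  bar p := (𝒲.bar p.1, 𝒰.bar p.2)
  bar_bar p := by simp [𝒲.bar_bar, 𝒰.bar_bar]
  U p := {y | ∃ h : y ∈ 𝒰.U p.2, (⟨(p.2, y), h⟩ : 𝒰.groupoid.Ob) ∈ 𝒲.U p.1}
  isOpen p := by
    have : {y | ∃ h : y ∈ 𝒰.U p.2, (⟨(p.2, y), h⟩ : 𝒰.groupoid.Ob) ∈ 𝒲.U p.1} =
        Subtype.val '' ((fun y : 𝒰.U p.2 => (⟨(p.2, y.1), y.2⟩ : 𝒰.groupoid.Ob)) ⁻¹'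
          𝒲.U p.1) := by
      ext y
      constructor
      · rintro ⟨h, h'⟩
        exact ⟨⟨y, h⟩, h', rfl⟩
      · rintro ⟨⟨y, h⟩, h', rfl⟩
        exact ⟨h, h'⟩
    rw [this]
    refine (𝒰.isOpen p.2).isOpenMap_subtype_val _ ((𝒲.isOpen p.1).preimage ?_)
    exact Continuous.subtype_mk (by fun_prop) _
  exists_mem y := by
    obtain ⟨j, hj⟩ := 𝒰.exists_mem y
    obtain ⟨w, hw⟩ := 𝒲.exists_mem ⟨(j, y), hj⟩
    exact ⟨(w, j), hj, hw⟩
  U_bar p := by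
    ext y
    constructor
    · rintro ⟨h, h'⟩
      have h1 := 𝒰.conj_mem h
      have h2 := 𝒲.conj_mem h'
      rw [𝒰.bar_bar] at h1
      rw [𝒲.bar_bar] at h2
      refine ⟨Γ.conjOb y, ⟨h1, ?_⟩, Γ.conjOb_conjOb y⟩
      have h3 : (⟨(p.2, Γ.conjOb y), h1⟩ : 𝒰.groupoid.Ob) =
          𝒰.groupoid.conjOb ⟨(𝒰.bar p.2, y), h⟩ :=
        Subtype.ext (Prod.ext (𝒰.bar_bar _).symm rfl)
      rw [h3]
      exact h2
    · rintro ⟨y, ⟨h, h'⟩, rfl⟩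
      exact ⟨𝒰.conj_mem h, 𝒲.conj_mem h'⟩

/-- The canonical identification `Γ[𝒰.refinement 𝒲] → Γ[𝒰][𝒲]`,
`((w₀, j₀), γ, (w₁, j₁)) ↦ (w₀, (j₀, γ, j₁), w₁)`. -/
def refineMap (𝒲 : RealCover 𝒰.groupoid) : StrictMor (𝒰.refinement 𝒲).groupoid 𝒲.groupoid where
  onOb x := ⟨(x.1.1.1, ⟨(x.1.1.2, x.1.2), x.2.1⟩), x.2.2⟩
  onArr p := ⟨(p.1.1.1, ⟨(p.1.1.2, p.1.2.1, p.1.2.2.2), ⟨p.2.1.1, p.2.2.1⟩⟩, p.1.2.2.1),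
    ⟨p.2.1.2, p.2.2.2⟩⟩
  continuous_onOb := by
    have h : Continuous (fun x : (𝒰.refinement 𝒲).groupoid.Ob => x.1) := continuous_subtype_val
    exact Continuous.subtype_mk (Continuous.prodMk (continuous_fst.comp (continuous_fst.comp h))
      (Continuous.subtype_mk (Continuous.prodMk (continuous_snd.comp (continuous_fst.comp h))
        (continuous_snd.comp h)) _)) _
  continuous_onArr := by
    have h : Continuous (fun x : (𝒰.refinement 𝒲).groupoid.Arr => x.1) := continuous_subtype_val
    have h2 := continuous_snd.comp h
    exact Continuous.subtype_mk (Continuous.prodMk (continuous_fst.comp (continuous_fst.comp h))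
      (Continuous.prodMk (Continuous.subtype_mk
        (Continuous.prodMk (continuous_snd.comp (continuous_fst.comp h))
        (Continuous.prodMk (continuous_fst.comp h2)
          (continuous_snd.comp (continuous_snd.comp h2)))) _)
        (continuous_fst.comp (continuous_snd.comp h2)))) _
  src_onArr _ := rfl
  rng_onArr _ := rfl
  map_unit _ := rfl
  map_mul _ _ _ := rfl
  conj_onOb _ := rfl
  conj_onArr _ := rfl

end RealCover

/-- A pair `(𝒰, f)` of a Real open cover `𝒰` of `Γ.Ob` and a Real strict morphism
`f : Γ[𝒰] → G`. -/
structure CoverPair (Γ G : RealGroupoid.{u}) : Type (u + 1) where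
  cover : RealCover Γ
  mor : StrictMor cover.groupoid G

namespace CoverPair

variable {Γ G H : RealGroupoid.{u}}

/-- The generalized morphism `Z_f ∘ Z_ι⁻¹` from `Γ` to `G`. -/
def toGenMor (p : CoverPair Γ G) : GenMor Γ G :=
  ((GenMor.ofStrict p.cover.iota).inv p.cover.isMorita_iota).comp (GenMor.ofStrict p.mor)

/-- Two pairs are isomorphic if the generalized morphisms `Z_f ∘ Z_ι⁻¹` are. -/
instance setoid (Γ G : RealGroupoid.{u}) : Setoid (CoverPair Γ G) where
  r p q := p.toGenMor.Isomorphic q.toGenMor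
  iseqv := ⟨fun _ => GenMor.Isomorphic.refl _, GenMor.Isomorphic.symm, GenMor.Isomorphic.trans⟩

/-- The pair `({Γ.Ob}, Γ[{Γ.Ob}] ≅ Γ)`. -/
def idPair (Γ : RealGroupoid.{u}) : CoverPair Γ Γ :=
  ⟨RealCover.trivialCover Γ, (RealCover.trivialCover Γ).iota⟩

/-- The choices in the construction of a composite `(𝒱, f_𝒱) ∘ (𝒰, f_𝒰)`: a pair `(𝒲, φ)` from
`Γ[𝒰]` to `G[𝒱]` representing the generalized morphism `Z_ι⁻¹ ∘ Z_{f_𝒰}`, where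
`ι : G[𝒱] → G`. -/
structure CompData (p : CoverPair Γ G) (q : CoverPair G H) : Type (u + 1) where
  pair : CoverPair p.cover.groupoid q.cover.groupoid
  iso : pair.toGenMor.Isomorphic ((GenMor.ofStrict p.mor).comp
    ((GenMor.ofStrict q.cover.iota).inv q.cover.isMorita_iota))

/-- The composite pair `(𝒰', f_𝒱 ∘ φ)`, where `𝒰'` is the refinement of `𝒰` given by `𝒲` and
`Γ[𝒰']` is identified with `Γ[𝒰][𝒲]`. -/
def CompData.composite {p : CoverPair Γ G} {q : CoverPair G H} (d : CompData p q) :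
    CoverPair Γ H :=
  ⟨p.cover.refinement d.pair.cover, ((p.cover.refineMap d.pair.cover).comp d.pair.mor).comp q.mor⟩

end CoverPair

/-- The set `Ω(Γ, G)` of isomorphism classes of pairs `(𝒰, f : Γ[𝒰] → G)`. -/
abbrev Omega (Γ G : RealGroupoid.{u}) : Type (u + 1) := Quotient (CoverPair.setoid Γ G)

/-- The category structure on the classes `Ω(Γ, G)`: the composite of the classes of two pairs is
the class of the composite pair, for every choice of representatives and of composition data,
composition data exist, and the category laws hold.  (There is at most one such structure.) -/
structure OmegaCategory : Type (u + 1) where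
  comp : ∀ {Γ G H : RealGroupoid.{u}}, Omega Γ G → Omega G H → Omega Γ H
  nonempty_compData : ∀ {Γ G H : RealGroupoid.{u}} (p : CoverPair Γ G) (q : CoverPair G H),
    Nonempty (CoverPair.CompData p q)
  comp_mk : ∀ {Γ G H : RealGroupoid.{u}} (p : CoverPair Γ G) (q : CoverPair G H)
    (d : CoverPair.CompData p q), comp ⟦p⟧ ⟦q⟧ = ⟦d.composite⟧
  id_comp : ∀ {Γ G : RealGroupoid.{u}} (a : Omega Γ G), comp ⟦CoverPair.idPair Γ⟧ a = a
  comp_id : ∀ {Γ G : RealGroupoid.{u}} (a : Omega Γ G), comp a ⟦CoverPair.idPair G⟧ = a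
  assoc : ∀ {Γ G H K : RealGroupoid.{u}} (a : Omega Γ G) (b : Omega G H) (c : Omega H K),
    comp (comp a b) c = comp a (comp b c)

/-- The category `RG_Ω`: objects are Real groupoids, morphisms from `Γ` to `G` are the elements
of `Ω(Γ, G)`. -/
def RGOmega (_ : OmegaCategory.{u}) : Type (u + 1) := RealGroupoid.{u}

instance (C : OmegaCategory.{u}) : Category.{u + 1} (RGOmega C) where
  Hom Γ G := Omega Γ G
  id Γ := ⟦CoverPair.idPair Γ⟧
  comp a b := C.comp a b
  id_comp := C.id_comp
  comp_id := C.comp_id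
  assoc := C.assoc

/-- A Real groupoid as an object of `RG`. -/
def RG.of (Γ : RealGroupoid.{u}) : RG.{u} := Γ

/-- The isomorphism class of a Real generalized morphism, as a morphism of `RG`. -/
def RG.mk {Γ G : RealGroupoid.{u}} (Z : GenMor Γ G) : RG.of Γ ⟶ RG.of G :=
  Quotient.mk (GenMor.isoSetoid Γ G) Z

/-- A Real groupoid as an object of `RG_Ω`. -/
def RGOmega.of (C : OmegaCategory.{u}) (Γ : RealGroupoid.{u}) : RGOmega C := Γ

/-- The class of a pair `(𝒰, f)`, as a morphism of `RG_Ω`. -/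
def RGOmega.mk (C : OmegaCategory.{u}) {Γ G : RealGroupoid.{u}} (p : CoverPair Γ G) :
    RGOmega.of C Γ ⟶ RGOmega.of C G :=
  Quotient.mk (CoverPair.setoid Γ G) p

/-!
In `RG` a Morita equivalence `Z` is invertible, with inverse `Z⁻¹`
(`GenMor.inv_comp_isomorphic_idMor`, `GenMor.comp_inv_isomorphic_idMor`), and `f ↦ Z_f` is
functorial (`GenMor.ofStrict_comp_isomorphic`).  So the class of `Z_f ∘ Z_ι⁻¹` is `[ι]⁻¹ ≫ [f]`
(composition in diagrammatic order), and all questions about composites of pairs become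
computations in the category `RG`.

The geometric input is that every generalized morphism `Z` from `Γ` to `G` comes from a pair
(`CoverPair.exists_isomorphic`).  Local sections of `rmap : Z → Γ.Ob` over an open cover define
a cocycle `Γ[𝒰] → G` by comparing `γ s(src γ)` with `s(rng γ)` in the principal bundle
(`RealCover.RealSection.strictMor`), and `Z` is recovered from this cocycle
(`RealCover.RealSection.ofStrict_strictMor_isomorphic`).  The sections have to be compatible with
the involutions, which is arranged by adding to each local section its conjugate, under a
different index (`RealCover.exists_realSection`).

Hence `[(𝒰, f)] ↦ [Z_f ∘ Z_ι⁻¹]` is a bijection of `Ω(Γ, G)` with the morphisms from `Γ` to `G` in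
`RG` (`Omega.equivHom`); it is injective by the very definition of the equivalence of pairs.  The
existence of composites is surjectivity, applied to a generalized morphism from `Γ[𝒰]` to `G[𝒱]`.
If `φ` on `Γ[𝒰][𝒲]` represents `[f_𝒰] ≫ [ι_𝒱]⁻¹`, the composite pair has the class
`[ι_𝒰]⁻¹ ≫ [ι_𝒲]⁻¹ ≫ [φ] ≫ [f_𝒱] = [ι_𝒰]⁻¹ ≫ [f_𝒰] ≫ [ι_𝒱]⁻¹ ≫ [f_𝒱]`, the composite of the two
classes in `RG` (`CoverPair.mk_toGenMor_composite`).  So it depends on no choice, and the category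
structure of `RG` is carried over to the sets `Ω(Γ, G)` by the bijections.
-/

/-! ### The division map of a principal bundle -/

namespace GenMor

variable {Γ G H : RealGroupoid.{u}}

lemma div_ract (Z : GenMor Γ G) (z w : Z.Z) (g : G.Arr) (e : Z.smap w = G.rng g)
    (h : Z.rmap z = Z.rmap w) (h' : Z.rmap z = Z.rmap (Z.ract w g e)) :
    Z.div ⟨(z, Z.ract w g e), h'⟩ = G.mul (Z.div ⟨(z, w), h⟩) g ((Z.src_div _).trans e) := by
  refine Z.div_eq _ _ _ _ ((Z.rng_div ⟨(z, w), h⟩).trans (G.rng_mul _ _ _).symm) ?_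
  rw [Z.ract_mul _ _ _ (Z.rng_div ⟨(z, w), h⟩) ((Z.src_div ⟨(z, w), h⟩).trans e)]
  congr 1
  exact Z.ract_div ⟨(z, w), h⟩

lemma div_ract_left (Z : GenMor Γ G) (z w : Z.Z) (g : G.Arr) (e : Z.smap z = G.rng g)
    (h : Z.rmap z = Z.rmap w) (h' : Z.rmap (Z.ract z g e) = Z.rmap w) :
    Z.div ⟨(Z.ract z g e, w), h'⟩ = G.mul (G.inv g) (Z.div ⟨(z, w), h⟩)
      ((G.src_inv g).trans (e.symm.trans (Z.rng_div ⟨(z, w), h⟩))) := by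
  have e1 : G.rng g = G.rng (Z.div ⟨(z, w), h⟩) := e.symm.trans (Z.rng_div ⟨(z, w), h⟩)
  refine Z.div_eq _ _ _ _ (by simp) ?_
  rw [← Z.ract_mul _ _ _ e (by simp)]
  simp only [G.mul_inv_cancel_left g _ e1]
  exact Z.ract_div ⟨(z, w), h⟩

lemma div_lact (Z : GenMor Γ G) (γ : Γ.Arr) (z w : Z.Z) (ez : Γ.src γ = Z.rmap z)
    (ew : Γ.src γ = Z.rmap w) (h : Z.rmap z = Z.rmap w)
    (h' : Z.rmap (Z.lact γ z ez) = Z.rmap (Z.lact γ w ew)) :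
    Z.div ⟨(Z.lact γ z ez, Z.lact γ w ew), h'⟩ = Z.div ⟨(z, w), h⟩ := by
  refine Z.div_eq _ _ _ _ ((Z.smap_lact _ _ _).trans (Z.rng_div ⟨(z, w), h⟩)) ?_
  rw [← Z.lact_ract _ _ _ ez (Z.rng_div ⟨(z, w), h⟩)]
  congr 1
  exact Z.ract_div ⟨(z, w), h⟩

lemma div_conj (Z : GenMor Γ G) (z w : Z.Z) (h : Z.rmap z = Z.rmap w)
    (h' : Z.rmap (Z.conj z) = Z.rmap (Z.conj w)) :
    Z.div ⟨(Z.conj z, Z.conj w), h'⟩ = G.conjArr (Z.div ⟨(z, w), h⟩) := by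
  have e := Z.rng_div ⟨(z, w), h⟩
  refine Z.div_eq _ _ _ _ (by simpa using congrArg G.conjOb e) ?_
  rw [← Z.conj_ract _ _ e]
  exact congrArg Z.conj (Z.ract_div ⟨(z, w), h⟩)

/-! ### Inverses of Morita equivalences -/

/-- The isomorphism `Z⁻¹ ×_Γ Z → G.Arr` sends `[z, w]` to the arrow `g` with `z g = w`. -/
lemma inv_comp_isomorphic_idMor (Z : GenMor Γ G) (hZ : IsMorita Z) :
    Isomorphic (comp (Z.inv hZ) Z) (idMor G) := by
  refine isomorphic_of_lift (Z := Z.inv hZ) (W := Z) (V := idMor G)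
    (fun p => ⟨(Z.smap p.1.1, Z.div ⟨(p.1.1, p.1.2), p.2⟩), Z.rng_div ⟨(p.1.1, p.1.2), p.2⟩⟩)
    ?_ ?_ ?_ ?_ ?_ ?_ ?_
  · have h1 : Continuous (Y := Z.Z) fun p : CompPt (Z.inv hZ) Z => p.1.1 :=
      continuous_fst.comp continuous_subtype_val
    have h2 : Continuous fun p : CompPt (Z.inv hZ) Z => p.1.2 :=
      continuous_snd.comp continuous_subtype_val
    exact Continuous.subtype_mk ((Z.continuous_smap.comp h1).prodMk
      (continuous_div' Z h1 h2 fun p => p.2)) _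
  · rintro ⟨⟨z, w⟩, hp⟩ ⟨⟨z', w'⟩, hq⟩ ⟨γ, e, h1, h2⟩
    have hp' : Z.rmap z = Z.rmap w := hp
    change z' = Z.lact (Γ.inv γ) z _ at h1
    simp only at h2
    subst h1 h2
    refine Subtype.ext (Prod.ext (Z.smap_lact _ _ _).symm ?_)
    exact (Z.div_lact _ _ _ _ _ hp' _).symm
  · exact fun p => rfl
  · exact fun p => Z.src_div ⟨(p.1.1, p.1.2), p.2⟩
  · exact fun p => Subtype.ext (Prod.ext (Z.smap_conj _) (Z.div_conj _ _ p.2 _))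
  · intro g p e
    refine Subtype.ext (Prod.ext ?_ ?_)
    · exact (Z.smap_ract _ _ _).trans (G.src_inv g)
    · refine (Z.div_ract_left p.1.1 p.1.2 _ _ p.2 _).trans ?_
      simp only [RealGroupoid.inv_inv]
      rfl
  · exact fun p g e => Subtype.ext (Prod.ext rfl (Z.div_ract p.1.1 p.1.2 g e p.2 _))

lemma IsMorita.inv {Z : GenMor Γ G} (hZ : IsMorita Z) : IsMorita (Z.inv hZ) where
  locallySplit := Z.locallySplit
  principal := by
    let e : {p : G.Arr × Z.Z // G.src p.1 = Z.smap p.2} ≃ₜ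
        {p : Z.Z × G.Arr // Z.smap p.1 = G.rng p.2} :=
      { toFun := fun p => ⟨(p.1.2, G.inv p.1.1), by simp [p.2]⟩
        invFun := fun p => ⟨(G.inv p.1.2, p.1.1), by simp [p.2]⟩
        left_inv := fun p => by simp
        right_inv := fun p => by simp
        continuous_toFun := by
          exact Continuous.subtype_mk
            (Continuous.prodMk (by fun_prop) (G.continuous_inv.comp (by fun_prop))) _
        continuous_invFun := by
          exact Continuous.subtype_mk
            ((G.continuous_inv.comp (by fun_prop)).prodMk (by fun_prop)) _ }
    exact Z.principal.comp e.isHomeomorph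

lemma inv_inv_isomorphic (Z : GenMor Γ G) (hZ : IsMorita Z) :
    Isomorphic ((Z.inv hZ).inv hZ.inv) Z := by
  refine ⟨Homeomorph.refl Z.Z, ⟨fun _ => rfl, fun _ => rfl, fun _ => rfl, fun γ z e => ?_,
    fun z g e => ?_⟩⟩
  · change Z.lact (Γ.inv (Γ.inv γ)) z _ = Z.lact γ z _
    simp only [RealGroupoid.inv_inv]
  · change Z.ract z (G.inv (G.inv g)) _ = Z.ract z g _
    simp only [RealGroupoid.inv_inv]

lemma comp_inv_isomorphic_idMor (Z : GenMor Γ G) (hZ : IsMorita Z) :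
    Isomorphic (comp Z (Z.inv hZ)) (idMor Γ) :=
  (comp_congr (Z.inv_inv_isomorphic hZ).symm (Isomorphic.refl _)).trans
    ((Z.inv hZ).inv_comp_isomorphic_idMor hZ.inv)

/-! ### Functoriality of `f ↦ Z_f` -/

/-- The isomorphism sends `[(y, g), (x, k)]` to `(y, h(g) k)`. -/
lemma ofStrict_comp_isomorphic (f : StrictMor Γ G) (h : StrictMor G H) :
    Isomorphic (comp (ofStrict f) (ofStrict h)) (ofStrict (f.comp h)) := by
  have e0 : ∀ p : CompPt (ofStrict f) (ofStrict h),
      H.src (h.onArr (arr f p.1.1)) = H.rng (arr h p.1.2) := fun p => by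
    rw [h.src_onArr, src_arr, p.2, rng_arr]
  refine isomorphic_of_lift (Z := ofStrict f) (W := ofStrict h) (V := ofStrict (f.comp h))
    (fun p => ⟨((ofStrict f).rmap p.1.1, H.mul (h.onArr (arr f p.1.1)) (arr h p.1.2) (e0 p)), by
      rw [H.rng_mul, h.rng_onArr, rng_arr]; rfl⟩) ?_ ?_ ?_ ?_ ?_ ?_ ?_
  · refine Continuous.subtype_mk (((ofStrict f).continuous_rmap.comp (by fun_prop)).prodMk
      (H.continuous_mul' (h.continuous_onArr.comp ((continuous_arr f).comp
        (continuous_fst.comp continuous_subtype_val)))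
        ((continuous_arr h).comp (continuous_snd.comp continuous_subtype_val)) _)) _
  · rintro ⟨⟨z, w⟩, hp⟩ ⟨⟨z', w'⟩, hq⟩ ⟨g, e, h1, h2⟩
    simp only at h1 h2 e
    subst h1 h2
    refine Subtype.ext (Prod.ext ((ofStrict f).rmap_ract z g e).symm ?_)
    have e1 : H.src (h.onArr (arr f z)) = H.rng (h.onArr g) := by
      rw [h.src_onArr, h.rng_onArr, src_arr, e]
    have e2 : H.rng (h.onArr g) = H.rng (arr h w) := e1.symm.trans (e0 ⟨(z, w), hp⟩)
    have e3 : h.onArr (G.inv g) = H.inv (h.onArr g) := by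
      refine H.eq_inv_of_mul _ _ (by simp) ?_
      rw [← h.map_mul _ _ (by simp)]
      simp
    change _ = H.mul (h.onArr (G.mul (arr f z) g ((src_arr f z).trans e)))
      (H.mul (h.onArr (G.inv g)) (arr h w) _) _
    simp only [h.map_mul, e3]
    rw [H.mul_assoc _ _ _ e1 (by simp)]
    simp only [H.mul_inv_cancel_left _ _ e2]
  · exact fun p => rfl
  · exact fun p => H.src_mul _ _ _
  · intro p
    refine Subtype.ext (Prod.ext rfl ?_)
    change H.mul (h.onArr (G.conjArr (arr f p.1.1))) (H.conjArr (arr h p.1.2)) _ =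
      H.conjArr (H.mul _ _ _)
    simp
  · intro γ p e
    refine Subtype.ext (Prod.ext rfl ?_)
    simp only [arr_lact, h.map_mul]
    exact H.mul_assoc _ _ _ _ (e0 p)
  · intro p k e
    refine Subtype.ext (Prod.ext rfl ?_)
    exact (H.mul_assoc _ _ _ (e0 p) _).symm

end GenMor

/-! ### The cocycle of a family of local sections -/

namespace RealCover

variable {Γ G : RealGroupoid.{u}}

/-- A Real section of the pullback of `Z` along `ι : ∐ⱼ Uⱼ → Γ.Ob`, i.e. a family of continuous
local sections `Uⱼ → Z` compatible with the involutions. -/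
structure RealSection (𝒰 : RealCover Γ) (Z : GenMor Γ G) : Type u where
  toFun : 𝒰.groupoid.Ob → Z.Z
  continuous_toFun : Continuous toFun
  rmap_toFun : ∀ x, Z.rmap (toFun x) = 𝒰.iota.onOb x
  conj_toFun : ∀ x, toFun (𝒰.groupoid.conjOb x) = Z.conj (toFun x)

namespace RealSection

variable {𝒰 : RealCover Γ} {Z : GenMor Γ G} (s : RealSection 𝒰 Z)

lemma src_eq (p : 𝒰.groupoid.Arr) :
    Γ.src (𝒰.iota.onArr p) = Z.rmap (s.toFun (𝒰.groupoid.src p)) := by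
  rw [s.rmap_toFun]; rfl

lemma rmap_eq (p : 𝒰.groupoid.Arr) : Z.rmap (s.toFun (𝒰.groupoid.rng p)) =
    Z.rmap (Z.lact (𝒰.iota.onArr p) (s.toFun (𝒰.groupoid.src p)) (s.src_eq p)) := by
  rw [Z.rmap_lact, s.rmap_toFun]; rfl

/-- The cocycle of the section `s`: the arrow `c` with `γ s(j₁, src γ) = s(j₀, rng γ) c`. -/
noncomputable def cocycle (p : 𝒰.groupoid.Arr) : G.Arr :=
  Z.div ⟨(s.toFun (𝒰.groupoid.rng p),
    Z.lact (𝒰.iota.onArr p) (s.toFun (𝒰.groupoid.src p)) (s.src_eq p)), s.rmap_eq p⟩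

lemma rng_cocycle (p : 𝒰.groupoid.Arr) :
    G.rng (s.cocycle p) = Z.smap (s.toFun (𝒰.groupoid.rng p)) := by
  exact (Z.rng_div ⟨(_, _), s.rmap_eq p⟩).symm

lemma src_cocycle (p : 𝒰.groupoid.Arr) :
    G.src (s.cocycle p) = Z.smap (s.toFun (𝒰.groupoid.src p)) :=
  (Z.src_div _).trans (Z.smap_lact _ _ _)

lemma ract_cocycle (p : 𝒰.groupoid.Arr) :
    Z.ract (s.toFun (𝒰.groupoid.rng p)) (s.cocycle p) (s.rng_cocycle p).symm =
      Z.lact (𝒰.iota.onArr p) (s.toFun (𝒰.groupoid.src p)) (s.src_eq p) :=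
  Z.ract_div ⟨(_, _), s.rmap_eq p⟩

/-- The defining property characterizes the cocycle.  The points `x` and `y` are kept apart from
`rng p` and `src p`, which they equal only propositionally when `p` is a unit, a product or a
conjugate. -/
lemma cocycle_eq (p : 𝒰.groupoid.Arr) (g : G.Arr) (x y : 𝒰.groupoid.Ob)
    (hx : 𝒰.groupoid.rng p = x) (hy : 𝒰.groupoid.src p = y) (e : Z.smap (s.toFun x) = G.rng g)
    (h : Z.ract (s.toFun x) g e = Z.lact (𝒰.iota.onArr p) (s.toFun y) (by
      rw [← hy]; exact s.src_eq p)) : s.cocycle p = g := by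
  subst hx hy
  exact Z.div_eq _ _ _ _ e h

/-- The strict morphism `Γ[𝒰] → G` given by the cocycle of `s`. -/
noncomputable def strictMor : StrictMor 𝒰.groupoid G where
  onOb x := Z.smap (s.toFun x)
  onArr := s.cocycle
  continuous_onOb := Z.continuous_smap.comp s.continuous_toFun
  continuous_onArr := Z.continuous_div'
    (s.continuous_toFun.comp 𝒰.groupoid.continuous_rng)
    (Z.continuous_lact' 𝒰.iota.continuous_onArr
      (s.continuous_toFun.comp 𝒰.groupoid.continuous_src) s.src_eq) s.rmap_eq
  src_onArr := s.src_cocycle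
  rng_onArr := s.rng_cocycle
  map_unit x := by
    refine s.cocycle_eq _ _ x x (by simp) (by simp) (by simp) ?_
    rw [Z.ract_unit]
    simp only [𝒰.iota.map_unit]
    exact (Z.unit_lact' _ _ _).symm
  map_mul p q e := by
    have e1 : G.src (s.cocycle p) = G.rng (s.cocycle q) := by
      rw [s.src_cocycle, s.rng_cocycle, e]
    refine s.cocycle_eq _ _ (𝒰.groupoid.rng p) (𝒰.groupoid.src q) (by simp) (by simp)
      (by rw [G.rng_mul, s.rng_cocycle]) ?_
    rw [Z.ract_mul _ _ _ (s.rng_cocycle p).symm e1]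
    simp only [𝒰.iota.map_mul, s.ract_cocycle]
    rw [Z.mul_lact _ _ _ (by simp [e]) (s.src_eq q), ← Z.lact_ract _ _ _ (s.src_eq p)
      (by rw [s.rng_cocycle, e])]
    simp only [e, s.ract_cocycle]
  conj_onOb x := by rw [s.conj_toFun, Z.smap_conj]
  conj_onArr p := by
    refine s.cocycle_eq _ _ (𝒰.groupoid.conjOb (𝒰.groupoid.rng p))
      (𝒰.groupoid.conjOb (𝒰.groupoid.src p)) (by simp) (by simp)
      (by rw [s.conj_toFun, Z.smap_conj, G.rng_conj, s.rng_cocycle]) ?_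
    simp only [s.conj_toFun, 𝒰.iota.conj_onArr]
    rw [← Z.conj_ract _ _ (s.rng_cocycle p).symm, ← Z.conj_lact _ _ (s.src_eq p), s.ract_cocycle]

/-- The pullback of `Z` along `ι : Γ[𝒰] → Γ` is the generalized morphism of the cocycle of `s`: the
section trivializes the pulled back bundle, by `(x, g) ↦ s(x) g`. -/
lemma ofStrict_strictMor_isomorphic :
    (GenMor.ofStrict s.strictMor).Isomorphic ((GenMor.ofStrict 𝒰.iota).comp Z) := by
  let u : 𝒰.groupoid.Ob → (GenMor.ofStrict 𝒰.iota).Z := fun x =>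
    ⟨(x, Γ.unit (𝒰.iota.onOb x)), (Γ.rng_unit _).symm⟩
  have hu : Continuous u := Continuous.subtype_mk (continuous_id.prodMk
    (Γ.continuous_unit.comp 𝒰.iota.continuous_onOb)) _
  let φ : (GenMor.ofStrict s.strictMor).Z → ((GenMor.ofStrict 𝒰.iota).comp Z).Z := fun p =>
    GenMor.compMk ⟨(u p.1.1, Z.ract (s.toFun p.1.1) p.1.2 p.2), by
      exact (Γ.src_unit _).trans ((Z.rmap_ract _ _ _).trans (s.rmap_toFun _)).symm⟩
  refine GenMor.IsEquivariant.isomorphic (φ := φ) ⟨fun p => rfl, fun p => Z.smap_ract _ _ _,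
    fun p => ?_, fun δ p e => ?_, fun p g e => ?_⟩ ?_
  · refine congrArg GenMor.compMk (Subtype.ext (Prod.ext ?_ ?_))
    · refine Subtype.ext (Prod.ext rfl ?_)
      exact (congrArg Γ.unit (𝒰.iota.conj_onOb _)).trans (Γ.conj_unit _).symm
    · refine Eq.trans ?_ (Z.conj_ract _ _ _).symm
      change Z.ract (s.toFun (𝒰.groupoid.conjOb p.1.1)) (G.conjArr p.1.2) _ = _
      simp only [s.conj_toFun]
  · obtain ⟨⟨x, g⟩, hg⟩ := p
    change 𝒰.groupoid.src δ = x at e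
    subst e
    have hg' : G.src (s.cocycle δ) = G.rng g := (s.src_cocycle δ).trans hg
    -- `[γ u(src δ), s(src δ) g] = [u(rng δ), γ s(src δ) g]` for the arrow `γ` underlying `δ`.
    refine GenMor.compMk_eq (𝒰.iota.onArr δ) (Γ.src_unit _) ?_ ?_
    · refine Subtype.ext (Prod.ext rfl ?_)
      change Γ.mul (𝒰.iota.onArr δ) (Γ.unit _) _ = Γ.mul (Γ.unit _) (𝒰.iota.onArr δ) _
      exact (Γ.mul_unit' _ _ _).trans (Γ.unit_mul' _ _ _).symm
    · refine (Z.ract_mul _ _ _ (s.rng_cocycle δ).symm hg').trans ?_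
      simp only [s.ract_cocycle]
      exact (Z.lact_ract _ _ _ _ _).symm
  · exact congrArg GenMor.compMk (Subtype.ext (Prod.ext rfl (Z.ract_mul _ _ _ p.2 e)))
  · refine GenMor.continuous_compMk.comp (Continuous.subtype_mk ((hu.comp
      (continuous_fst.comp continuous_subtype_val)).prodMk (Z.continuous_ract'
        (s.continuous_toFun.comp (continuous_fst.comp continuous_subtype_val))
        (continuous_snd.comp continuous_subtype_val) _)) _)

end RealSection

/-! ### Existence of Real families of local sections -/

/-- A map on `∐ⱼ Uⱼ`, realized as a subspace of `J × Γ.Ob`, is continuous if it is so on each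
`Uⱼ`. -/
lemma continuous_of_forall_continuous {A : Type u} [TopologicalSpace A] (𝒰 : RealCover Γ)
    (s : ∀ j, 𝒰.U j → A) (hs : ∀ j, Continuous (s j)) :
    Continuous fun x : 𝒰.groupoid.Ob => s x.1.1 ⟨x.1.2, x.2⟩ := by
  refine IsLocallySplit.continuous_of_comp
    (p := fun x : Σ j, 𝒰.U j => (⟨(x.1, x.2.1), x.2.2⟩ : 𝒰.groupoid.Ob)) ?_
    (continuous_sigma hs)
  intro b
  have hmem : ∀ x : {x : 𝒰.groupoid.Ob | x.1.1 = b.1.1}, x.1.1.2 ∈ 𝒰.U b.1.1 := by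
    rintro ⟨x, hx : x.1.1 = b.1.1⟩
    exact Eq.subst (motive := fun j => x.1.2 ∈ 𝒰.U j) hx x.2
  refine ⟨{x | x.1.1 = b.1.1}, (isOpen_discrete {b.1.1}).preimage
    (continuous_fst.comp continuous_subtype_val), rfl,
    fun x => ⟨b.1.1, ⟨x.1.1.2, hmem x⟩⟩, ?_, ?_⟩
  · exact continuous_sigmaMk.comp (Continuous.subtype_mk
      (continuous_snd.comp (continuous_subtype_val.comp continuous_subtype_val)) _)
  · rintro ⟨x, hx⟩
    exact Subtype.ext (Prod.ext hx.symm rfl)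

/-- Every local section `σ : U → Z` has a conjugate section over the conjugate of `U`; indexing the
two by different indices, exchanged by the involution, makes any family of local sections
Real. -/
lemma exists_realSection (Z : GenMor Γ G) : ∃ 𝒰 : RealCover Γ, Nonempty (RealSection 𝒰 Z) := by
  choose U hU hy σ hσ hs using Z.locallySplit
  let _ : TopologicalSpace (Γ.Ob × Bool) := ⊥
  have : DiscreteTopology (Γ.Ob × Bool) := ⟨rfl⟩
  let V : Γ.Ob × Bool → Set Γ.Ob
    | (y, false) => U y
    | (y, true) => Γ.conjOb ⁻¹' U y
  let 𝒰 : RealCover Γ :=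
    { J := Γ.Ob × Bool
      bar := fun j => (j.1, !j.2)
      bar_bar := fun j => by simp
      U := V
      isOpen := by
        rintro ⟨y, _ | _⟩
        · exact hU y
        · exact (hU y).preimage Γ.continuous_conjOb
      exists_mem := fun y => ⟨(y, false), hy y⟩
      U_bar := by
        have hi : Function.Involutive Γ.conjOb := Γ.conjOb_conjOb
        rintro ⟨y, _ | _⟩
        · exact (congrFun hi.image_eq_preimage_symm (U y)).symm
        · exact ((congrFun hi.image_eq_preimage_symm _).trans (by
            rw [← Set.preimage_comp, hi.comp_self, Set.preimage_id]; rfl)).symm }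
  let s : ∀ j, 𝒰.U j → Z.Z
    | (y, false) => fun x => σ y x
    | (y, true) => fun x => Z.conj (σ y ⟨Γ.conjOb x.1, x.2⟩)
  refine ⟨𝒰, ⟨⟨fun x => s x.1.1 ⟨x.1.2, x.2⟩, 𝒰.continuous_of_forall_continuous s ?_, ?_, ?_⟩⟩⟩
  · rintro ⟨y, _ | _⟩
    · exact hσ y
    · exact Z.continuous_conj.comp ((hσ y).comp (Continuous.subtype_mk
        (Γ.continuous_conjOb.comp continuous_subtype_val) _))
  · rintro ⟨⟨⟨y, _ | _⟩, x⟩, hx⟩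
    · exact hs y _
    · exact (Z.rmap_conj _).trans ((congrArg Γ.conjOb (hs y _)).trans (Γ.conjOb_conjOb x))
  · rintro ⟨⟨⟨y, _ | _⟩, x⟩, hx⟩
    · change Z.conj (σ y ⟨Γ.conjOb (Γ.conjOb x), _⟩) = Z.conj (σ y ⟨x, _⟩)
      simp only [Γ.conjOb_conjOb]
    · exact (Z.conj_conj _).symm

end RealCover

/-! ### Strict morphisms and Morita equivalences in `RG` -/

namespace RG

variable {Γ G H : RealGroupoid.{u}}

/-- The class of `Z_f`, as a morphism of `RG`. -/
def ofStrict (f : StrictMor Γ G) : RG.of Γ ⟶ RG.of G :=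
  RG.mk (GenMor.ofStrict f)

lemma mk_eq_mk {Z W : GenMor Γ G} : RG.mk Z = RG.mk W ↔ Z.Isomorphic W :=
  Quotient.eq (r := GenMor.isoSetoid Γ G)

lemma ofStrict_comp (f : StrictMor Γ G) (h : StrictMor G H) :
    RG.ofStrict (f.comp h) = RG.ofStrict f ≫ RG.ofStrict h :=
  (mk_eq_mk.2 (GenMor.ofStrict_comp_isomorphic f h)).symm

/-- A Morita equivalence is an isomorphism in `RG`. -/
def isoOfMorita (Z : GenMor Γ G) (hZ : GenMor.IsMorita Z) : RG.of Γ ≅ RG.of G where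
  hom := RG.mk Z
  inv := RG.mk (Z.inv hZ)
  hom_inv_id := mk_eq_mk.2 (Z.comp_inv_isomorphic_idMor hZ)
  inv_hom_id := mk_eq_mk.2 (Z.inv_comp_isomorphic_idMor hZ)

/-- The isomorphism `Γ[𝒰] ≅ Γ` of `RG` given by `ι`. -/
def iotaIso (𝒰 : RealCover Γ) : RG.of 𝒰.groupoid ≅ RG.of Γ :=
  isoOfMorita (GenMor.ofStrict 𝒰.iota) 𝒰.isMorita_iota

/-- `Γ[𝒰'] ≅ Γ` factors as `Γ[𝒰'] → Γ[𝒰][𝒲] ≅ Γ[𝒰] ≅ Γ` for the refinement `𝒰'` of `𝒰` given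
by `𝒲`. -/
lemma iotaIso_refinement_hom (𝒰 : RealCover Γ) (𝒲 : RealCover 𝒰.groupoid) :
    (iotaIso (𝒰.refinement 𝒲)).hom =
      RG.ofStrict (𝒰.refineMap 𝒲) ≫ (iotaIso 𝒲).hom ≫ (iotaIso 𝒰).hom := by
  have h : (𝒰.refinement 𝒲).iota = (𝒰.refineMap 𝒲).comp (𝒲.iota.comp 𝒰.iota) := rfl
  change RG.ofStrict (𝒰.refinement 𝒲).iota = _
  rw [h, ofStrict_comp, ofStrict_comp]
  rfl

end RG

/-! ### Pairs as morphisms of `RG` -/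

namespace CoverPair

variable {Γ G H : RealGroupoid.{u}}

lemma mk_toGenMor (p : CoverPair Γ G) :
    RG.mk p.toGenMor = (RG.iotaIso p.cover).inv ≫ RG.ofStrict p.mor := rfl

/-- Every Real generalized morphism is represented by a pair, namely by the cocycle of a Real family
of local sections. -/
lemma exists_isomorphic (Z : GenMor Γ G) : ∃ p : CoverPair Γ G, p.toGenMor.Isomorphic Z := by
  obtain ⟨𝒰, ⟨s⟩⟩ := RealCover.exists_realSection Z
  refine ⟨⟨𝒰, s.strictMor⟩, RG.mk_eq_mk.1 ?_⟩
  rw [mk_toGenMor, Iso.inv_comp_eq]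
  exact RG.mk_eq_mk.2 s.ofStrict_strictMor_isomorphic

lemma nonempty_compData (p : CoverPair Γ G) (q : CoverPair G H) : Nonempty (CompData p q) := by
  obtain ⟨r, hr⟩ := exists_isomorphic ((GenMor.ofStrict p.mor).comp
    ((GenMor.ofStrict q.cover.iota).inv q.cover.isMorita_iota))
  exact ⟨⟨r, hr⟩⟩

/-- Every choice of composition data yields the composite of the two classes in `RG`. -/
lemma mk_toGenMor_composite {p : CoverPair Γ G} {q : CoverPair G H} (d : CompData p q) :
    RG.mk d.composite.toGenMor = RG.mk p.toGenMor ≫ RG.mk q.toGenMor := by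
  have h1 : (RG.iotaIso d.pair.cover).inv ≫ RG.ofStrict d.pair.mor =
      RG.ofStrict p.mor ≫ (RG.iotaIso q.cover).inv := RG.mk_eq_mk.2 d.iso
  rw [mk_toGenMor, Iso.inv_comp_eq]
  change _ = (RG.iotaIso (p.cover.refinement d.pair.cover)).hom ≫ _
  change RG.ofStrict (((p.cover.refineMap d.pair.cover).comp d.pair.mor).comp q.mor) = _
  rw [RG.iotaIso_refinement_hom, RG.ofStrict_comp, RG.ofStrict_comp, mk_toGenMor, mk_toGenMor]
  simp only [Category.assoc, Iso.hom_inv_id_assoc]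
  rw [← reassoc_of% h1]
  simp only [Iso.hom_inv_id_assoc]

lemma mk_toGenMor_idPair (Γ : RealGroupoid.{u}) : RG.mk (idPair Γ).toGenMor = 𝟙 (RG.of Γ) :=
  (RG.iotaIso (RealCover.trivialCover Γ)).inv_hom_id

end CoverPair

/-! ### The category `RG_Ω` -/

namespace Omega

variable {Γ G H : RealGroupoid.{u}}

/-- `Ω(Γ, G)` is the set of morphisms from `Γ` to `G` in `RG`, by
`[(𝒰, f)] ↦ [Z_f ∘ Z_ι⁻¹]`. -/
noncomputable def equivHom (Γ G : RealGroupoid.{u}) : Omega Γ G ≃ (RG.of Γ ⟶ RG.of G) :=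
  Equiv.ofBijective
    (Quotient.lift (fun p => RG.mk p.toGenMor) fun _ _ h => RG.mk_eq_mk.2 h) <| by
    constructor
    · rintro ⟨p⟩ ⟨q⟩ h
      exact Quotient.sound (RG.mk_eq_mk.1 h)
    · rintro ⟨Z⟩
      obtain ⟨p, hp⟩ := CoverPair.exists_isomorphic Z
      exact ⟨⟦p⟧, RG.mk_eq_mk.2 hp⟩

@[simp] lemma equivHom_mk (p : CoverPair Γ G) : equivHom Γ G ⟦p⟧ = RG.mk p.toGenMor := rfl

/-- The composition on the sets `Ω(Γ, G)` that corresponds to the one of `RG`. -/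
noncomputable def category : OmegaCategory.{u} where
  comp a b := (equivHom _ _).symm (equivHom _ _ a ≫ equivHom _ _ b)
  nonempty_compData := CoverPair.nonempty_compData
  comp_mk p q d := by
    rw [Equiv.symm_apply_eq]
    exact (CoverPair.mk_toGenMor_composite d).symm
  id_comp a := by
    rw [Equiv.symm_apply_eq, equivHom_mk, CoverPair.mk_toGenMor_idPair, Category.id_comp]
  comp_id a := by
    rw [Equiv.symm_apply_eq, equivHom_mk, CoverPair.mk_toGenMor_idPair, Category.comp_id]
  assoc a b c := by simp

/-- The functor `RG ⥤ RG_Ω` that is the identity on objects and sends the class of `Z` to the class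
of the pairs representing `Z`. -/
noncomputable def functor : RG.{u} ⥤ RGOmega category.{u} where
  obj Γ := Γ
  map {Γ G} a := (equivHom Γ G).symm a
  map_id Γ := by
    refine (Equiv.symm_apply_eq _).2 ?_
    exact (CoverPair.mk_toGenMor_idPair Γ).symm
  map_comp {Γ G H} a b := by
    refine congrArg (equivHom Γ H).symm ?_
    exact (congrArg₂ (fun (x : RG.of Γ ⟶ RG.of G) (y : RG.of G ⟶ RG.of H) => x ≫ y)
      ((equivHom Γ G).apply_symm_apply a) ((equivHom G H).apply_symm_apply b)).symm

/-- The functor `RG_Ω ⥤ RG` that is the identity on objects and sends the class of `(𝒰, f)` to the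
class of `Z_f ∘ Z_ι⁻¹`; it is inverse to `Omega.functor`. -/
noncomputable def inverse : RGOmega category.{u} ⥤ RG.{u} where
  obj Γ := Γ
  map {Γ G} a := equivHom Γ G a
  map_id Γ := CoverPair.mk_toGenMor_idPair Γ
  map_comp {Γ _ H} _ _ := (equivHom Γ H).apply_symm_apply _

end Omega

theorem mainTheorem12 :
    ∃ (C : OmegaCategory.{u}) (F : RG.{u} ⥤ RGOmega C)
      (hF : ∀ Γ : RealGroupoid.{u}, F.obj (RG.of Γ) = RGOmega.of C Γ),
      (∀ (Γ G : RealGroupoid.{u}) (Z : GenMor Γ G) (p : CoverPair Γ G),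
        F.map (RG.mk Z) = eqToHom (hF Γ) ≫ RGOmega.mk C p ≫ eqToHom (hF G).symm ↔
          Z.Isomorphic p.toGenMor) ∧
      ∃ K : RGOmega C ⥤ RG.{u}, F ⋙ K = 𝟭 RG.{u} ∧ K ⋙ F = 𝟭 (RGOmega C) := by
  refine ⟨Omega.category, Omega.functor, fun _ => rfl, fun Γ G Z p => ?_, Omega.inverse, ?_, ?_⟩
  · have h : (eqToHom rfl ≫ RGOmega.mk Omega.category p ≫ eqToHom rfl :
        RGOmega.of Omega.category Γ ⟶ RGOmega.of Omega.category G) =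
        RGOmega.mk Omega.category p := by simp
    rw [← RG.mk_eq_mk]
    refine Iff.trans (Eq.congr_right h) ?_
    exact Equiv.symm_apply_eq (Omega.equivHom Γ G) (y := ⟦p⟧)
  · exact Functor.hext (fun _ => rfl) fun Γ G a =>
      heq_of_eq ((Omega.equivHom Γ G).apply_symm_apply a)
  · exact Functor.hext (fun _ => rfl) fun Γ G a =>
      heq_of_eq ((Omega.equivHom Γ G).symm_apply_apply a)
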